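/- Let $m\le n$, let $X=(x_{ij})$ be an $m\times n$ matrix of indeterminates, let $\partial=(\partial/\partial x_{ij})$ be the corresponding matrix of partial derivatives, and put $P=\det(XX^{\mathrm T})$. Then $$\det(\partial\partial^{\mathrm T})\,P^s=\Big(\prod_{j=0}^{m-1}(2s+j)(2s+n-m-1+j)\Big)P^{s-1}.$$ More generally, if $I,J\subseteq[m]=\{1,\dots,m\}$ with $|I|=|J|=k$, then $$\det[(\partial\partial^{\mathrm T})_{IJ}]\,P^s=\Big(\prod_{j=0}^{k-1}(2s+j)(2s+n-m-1+j)\Big)P^{s-1}\,\epsilon(I,J)\,\det[(XX^{\mathrm T})_{I^cJ^c}].$$ Here $A_{IJ}$ is the submatrix of $A$ with rows $I$ and columns $J$ in their original order, $I^c=[m]\setminus I$, $\epsilon(I,J)=(-1)^{\sum_{i\in I}i+\sum_{j\in J}j}$, and an empty determinant is $1$. Both identities hold in each of the following senses: 1. for every integer $s\ge1$, in the polynomial ring $R[x_{ij}]$ over any commutative ring $R$; 2. for every integer $s$, in the field of rational fractions $K(x_{ij})$ over any field $K$; 3. for symbolic $s$ and any field $K$ of characteristic $0$, in the free rank-one module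 $K[x,s,P^{-1}]\,P^s$ over $K[x,s,P^{-1}]$, with $\frac{\partial}{\partial x_{ij}}(fP^s)=\big(\frac{\partial f}{\partial x_{ij}}+sf\frac{\partial P}{\partial x_{ij}}P^{-1}\big)P^s$ and $P^{s-1}=P^{-1}P^s$; 4. for every $s\in\mathbb C$, pointwise on every open set $U$ of real, or of complex, $m\times n$ matrices, for every branch of $P^s$ on $U$, i.e. every function $P^s:U\to\mathbb C$ that near each point of $U$ equals $e^{sL}$ for some continuous $L$ with $e^{L}=P$ (so $P$ has no zeros on $U$); here $P^{s-1}=P^s/P$. -/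

import Mathlib

namespace RectCayley

open Finset Topology

noncomputable section

/-! ### Minors, signs, the constant -/

/-- The submatrix of `A` with rows `I` and columns `J`, in their original order, for `k`-element
sets `I` and `J`. -/
def sub {α : Type*} {m k : ℕ} (A : Matrix (Fin m) (Fin m) α) {I J : Finset (Fin m)}
    (hI : I.card = k) (hJ : J.card = k) : Matrix (Fin k) (Fin k) α :=
  A.submatrix (I.orderEmbOfFin hI) (J.orderEmbOfFin hJ)

theorem card_compl_of_card {m k : ℕ} {I : Finset (Fin m)} (hI : I.card = k) :
    Iᶜ.card = m - k := by
  simp [Finset.card_compl, hI]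

/-- The determinant of `A` with rows in the complement of `I` and columns in the complement
of `J`. -/
def complMinor {R : Type*} [CommRing R] {m k : ℕ} (A : Matrix (Fin m) (Fin m) R)
    {I J : Finset (Fin m)} (hI : I.card = k) (hJ : J.card = k) : R :=
  (sub A (card_compl_of_card hI) (card_compl_of_card hJ)).det

/-- `ε(I, J) = (-1) ^ (∑_{i ∈ I} i + ∑_{j ∈ J} j)`, with the elements of `Fin m` read as the numbers
`1, …, m`. -/
def eps {m : ℕ} (I J : Finset (Fin m)) : ℤ :=
  (-1) ^ (∑ i ∈ I, (i.val + 1) + ∑ j ∈ J, (j.val + 1))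

/-- `b_k(s) = ∏_{j=0}^{k-1} (2s + j) (2s + n - m - 1 + j)`. -/
def coeff {R : Type*} [CommRing R] (m n k : ℕ) (s : R) : R :=
  ∏ j ∈ range k, (2 * s + j) * (2 * s + n - m - 1 + j)

/-! ### Determinants of matrices of operators -/

section Operators

variable {M : Type*} [AddCommGroup M]

/-- The matrix `∂ ∂ᵀ` of operators on `M`; the product of two operators is their composite. -/
def gramOp {m n : ℕ} (D : Fin m → Fin n → M → M) : Matrix (Fin m) (Fin m) (M → M) :=
  fun i j f => ∑ c, D i c (D j c f)

/-- The determinant of a matrix of operators on `M`, as an operator on `M`: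
`∑_σ sgn(σ) A_{σ(1),1} ∘ ⋯ ∘ A_{σ(k),k}`. It is used for operators that commute with
each other, so that the order of the factors is immaterial. -/
def opDet {k : ℕ} (A : Matrix (Fin k) (Fin k) (M → M)) : M → M :=
  fun f => ∑ σ : Equiv.Perm (Fin k), (Equiv.Perm.sign σ : ℤ) •
    (List.ofFn fun a => A (σ a) a).foldr (fun T g => T g) f

end Operators

/-! ### Matrices of indeterminates -/

/-- The `m × n` matrix of indeterminates over `R`. -/
def genMat (m n : ℕ) (R : Type*) [CommRing R] :
    Matrix (Fin m) (Fin n) (MvPolynomial (Fin m × Fin n) R) :=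
  fun i j => MvPolynomial.X (i, j)

/-- The matrix `X Xᵀ`. -/
def genGram (m n : ℕ) (R : Type*) [CommRing R] :
    Matrix (Fin m) (Fin m) (MvPolynomial (Fin m × Fin n) R) :=
  genMat m n R * (genMat m n R).transpose

/-- `∂/∂x_{ij}` on polynomials. -/
def polyD (m n : ℕ) (R : Type*) [CommRing R] (i : Fin m) (j : Fin n) :
    MvPolynomial (Fin m × Fin n) R → MvPolynomial (Fin m × Fin n) R :=
  MvPolynomial.pderiv (i, j)

/-! ### Derivatives of fractions -/

section Loc

variable {R A : Type*} [CommRing R] [CommRing A] [Algebra R A]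

/-- The extension of a derivation `d` of `A` to a localization of `A`, by the quotient rule
`d(a/b) = (b da - a db)/b²`. -/
def locD (S : Submonoid A) (d : Derivation R A A) (f : Localization S) : Localization S :=
  let a := (IsLocalization.sec S f).1
  let b := (IsLocalization.sec S f).2
  IsLocalization.mk' (Localization S) ((b : A) * d a - a * d b) (b * b)

/-- The value of `locD` does not depend on how the fraction is written. -/
theorem locD_mk' (S : Submonoid A) (d : Derivation R A A) (a : A) (b : S) :
    locD S d (IsLocalization.mk' (Localization S) a b) =
      IsLocalization.mk' (Localization S) ((b : A) * d a - a * d b) (b * b) := by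
  have h := IsLocalization.mk'_sec (M := S) (Localization S)
    (IsLocalization.mk' (Localization S) a b)
  simp only [locD]
  generalize (IsLocalization.sec S (IsLocalization.mk' (Localization S) a b)).1 = a' at *
  generalize (IsLocalization.sec S (IsLocalization.mk' (Localization S) a b)).2 = b' at *
  rw [IsLocalization.mk'_eq_iff_eq, IsLocalization.eq_iff_exists S] at h
  obtain ⟨c, hc⟩ := h
  rw [IsLocalization.mk'_eq_iff_eq, IsLocalization.eq_iff_exists S]
  refine ⟨c * c, ?_⟩
  have hd := congrArg d hc
  simp only [Derivation.leibniz, smul_eq_mul] at hd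
  simp only [Submonoid.coe_mul]
  linear_combination (c : A) * b * b' * hd - (c * b' * d b + c * b * d b' + d c * b * b') * hc

end Loc

/-- `∂/∂x_{ij}` on the field `K(x)` of rational fractions. -/
def ratD (m n : ℕ) (K : Type*) [Field K] (i : Fin m) (j : Fin n) :
    FractionRing (MvPolynomial (Fin m × Fin n) K) →
      FractionRing (MvPolynomial (Fin m × Fin n) K) :=
  locD (nonZeroDivisors _) (MvPolynomial.pderiv (i, j))

/-- The image of a polynomial in the field of rational fractions. -/
def toRat {m n : ℕ} {K : Type*} [Field K] (p : MvPolynomial (Fin m × Fin n) K) :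
    FractionRing (MvPolynomial (Fin m × Fin n) K) :=
  algebraMap _ _ p

/-! ### The module `K[x, s, P⁻¹] P^s` -/

/-- The ring `K[s][x] = K[x, s]`. -/
abbrev PolyS (m n : ℕ) (K : Type*) [Field K] : Type _ :=
  MvPolynomial (Fin m × Fin n) (Polynomial K)

/-- The symbol `s` in `K[x, s]`. -/
def symS (m n : ℕ) (K : Type*) [Field K] : PolyS m n K := MvPolynomial.C Polynomial.X

/-- The ring `K[x, s, P⁻¹]`. It also serves as its free module of rank one `K[x, s, P⁻¹] P^s`, in
which `f` stands for `f P^s`: so `1` stands for `P^s`, and `P⁻¹` stands for `P^(s-1)`. -/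
abbrev SymPow {m n : ℕ} {K : Type*} [Field K] (P : PolyS m n K) : Type _ :=
  Localization.Away P

/-- The element `P^s` of `K[x, s, P⁻¹] P^s`. -/
def powS {m n : ℕ} {K : Type*} [Field K] (P : PolyS m n K) : SymPow P := 1

/-- The element `P^(s-1) = P⁻¹ P^s` of `K[x, s, P⁻¹] P^s`. -/
def powSPred {m n : ℕ} {K : Type*} [Field K] (P : PolyS m n K) : SymPow P :=
  IsLocalization.Away.invSelf P

/-- `∂/∂x_{ij} (f P^s) = (∂f/∂x_{ij} + s f (∂P/∂x_{ij}) P⁻¹) P^s`. -/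
def symD {m n : ℕ} {K : Type*} [Field K] (P : PolyS m n K) (i : Fin m) (j : Fin n)
    (f : SymPow P) : SymPow P :=
  locD (Submonoid.powers P) (MvPolynomial.pderiv (i, j)) f +
    algebraMap (PolyS m n K) (SymPow P) (symS m n K) * f *
      algebraMap (PolyS m n K) (SymPow P) (MvPolynomial.pderiv (i, j) P) *
      IsLocalization.Away.invSelf P

/-! ### Functions of real or complex variables -/

section Analytic

variable (𝕜 : Type*) [NontriviallyNormedField 𝕜] [NormedAlgebra 𝕜 ℂ]

/-- `∂/∂x_{ij}` on complex-valued functions of an `m × n` matrix with entries in `𝕜`. -/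
def funD (m n : ℕ) (i : Fin m) (j : Fin n) (F : Matrix (Fin m) (Fin n) 𝕜 → ℂ) :
    Matrix (Fin m) (Fin n) 𝕜 → ℂ :=
  fun Y => lineDeriv 𝕜 F Y (Matrix.single i j 1)

/-- The function `Y ↦ det (Y Yᵀ)`. -/
def gramDet (m n : ℕ) (Y : Matrix (Fin m) (Fin n) 𝕜) : ℂ :=
  algebraMap 𝕜 ℂ (Y * Y.transpose).det

end Analytic

/-- `F` is a branch of `P^s` on `U` (where `P` then has no zeros): near each point of `U`, it is
`exp (s L)` for a continuous logarithm `L` of `P`. The corresponding branch of `P^(s-1)`, which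
near that point is `exp ((s-1) L)`, is `F / P`. -/
def IsPowBranch {E : Type*} [TopologicalSpace E] (P : E → ℂ) (s : ℂ) (U : Set E) (F : E → ℂ) :
    Prop :=
  ∀ x ∈ U, ∃ V ∈ 𝓝 x, ∃ L : E → ℂ, ContinuousOn L V ∧
    ∀ y ∈ V, Complex.exp (L y) = P y ∧ F y = Complex.exp (s * L y)

end

end RectCayley

namespace RectCayley

open Finset Topology

noncomputable section

/-! ### Determinants of operators: transfer and expansion along the first column -/

section OpDet

variable {M M' : Type*} [AddCommGroup M] [AddCommGroup M']

/-! Put G = XXᵀ, Q = G⁻¹, Y = QX. Since ∂P/∂x_{ic} = 2 Y_{ic} P, conjugation by P^s turns ∂_{ic}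
into T_{ic} = ∂_{ic} + t Y_{ic} with t = 2s, and the question becomes what a minor of TTᵀ does to 1.
The answer (`opDet_twist`) is b_k(s) det Q_{IJ}. Jacobi's identity (`det_sub_inv_mul_det`) and the
symmetry of G turn P det Q_{IJ} into ε(I,J) times the complementary minor of G.

`opDet_twist` is an induction on k by Laplace expansion along the first column, with row indices r
and first column index w₀. The alternating sum over a of T_{r_a,c} applied to the k-minors of Q
gives t + k times a determinant of size k + 1 whose first column is Y_{·c} and whose other columns
come from Q (`sum_twist_minor`). Then ∑_c T_{w₀,c} replaces that first column by column w₀ of Q,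
with factor t + n - m - 1 + k (`sum_twist_colMat`). Beyond commutation and symmetry, this needs only
YYᵀ = Q, the formula for ∂Q, and ∑_c ∂_{jc} Y_{ic} = (n - m - 1) Q_{ij}.

The computation is valid in any localization of the polynomial ring where P is invertible, which
covers rational fractions and symbolic s. Polynomials over R are reached from ℤ[x], which embeds in
ℚ(x); branches are reached by evaluating the symbolic identity. All transfers rest on `opDet_mem`: a
subgroup of M × M', seen as an additive relation, that the entries of the operator matrices preserve
is preserved by their determinants. -/

theorem opDet_mem {k : ℕ} (H : AddSubgroup (M × M')) {A : Matrix (Fin k) (Fin k) (M → M)}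
    {A' : Matrix (Fin k) (Fin k) (M' → M')}
    (hA : ∀ a b f g, (f, g) ∈ H → (A a b f, A' a b g) ∈ H) {f : M} {g : M'} (h : (f, g) ∈ H) :
    (opDet A f, opDet A' g) ∈ H := by
  -- The pair is itself a signed sum in M × M', so closure of `H` under sums and integer multiples
  -- reduces the claim to one composite of entries.
  have key : (opDet A f, opDet A' g) = ∑ σ : Equiv.Perm (Fin k), (Equiv.Perm.sign σ : ℤ) •
      ((List.ofFn fun a => A (σ a) a).foldr (fun T u => T u) f,
        (List.ofFn fun a => A' (σ a) a).foldr (fun T u => T u) g) := by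
    ext <;> simp [opDet, Prod.fst_sum, Prod.snd_sum]
  rw [key]
  refine sum_mem fun σ _ => zsmul_mem ?_ _
  have aux : ∀ (l : ℕ) (B : Fin l → M → M) (B' : Fin l → M' → M'),
      (∀ a f g, (f, g) ∈ H → (B a f, B' a g) ∈ H) →
      ((List.ofFn B).foldr (fun T u => T u) f, (List.ofFn B').foldr (fun T u => T u) g) ∈ H := by
    intro l
    induction l with
    | zero => intro B B' _; simpa using h
    | succ l ih =>
      intro B B' hB
      simp only [List.ofFn_succ, List.foldr_cons]
      exact hB _ _ _ (ih _ _ fun a => hB a.succ)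
  exact aux k _ _ fun a => hA (σ a) a

theorem gramOp_mem {m n : ℕ} (H : AddSubgroup (M × M')) {D : Fin m → Fin n → M → M}
    {D' : Fin m → Fin n → M' → M'}
    (hD : ∀ i c f g, (f, g) ∈ H → (D i c f, D' i c g) ∈ H) (i j : Fin m) (f : M) (g : M')
    (h : (f, g) ∈ H) : (gramOp D i j f, gramOp D' i j g) ∈ H := by
  have key : (gramOp D i j f, gramOp D' i j g) =
      ∑ c, (D i c (D j c f), D' i c (D' j c g)) := by
    ext <;> simp [gramOp, Prod.fst_sum, Prod.snd_sum]
  rw [key]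
  exact sum_mem fun c _ => hD _ _ _ _ (hD _ _ _ _ h)

theorem opDet_zero (A : Matrix (Fin 0) (Fin 0) (M → M)) (f : M) : opDet A f = f := by
  simp [opDet]

/-- The factor from column 0 is outermost in each composite, so no commutation is needed: additivity
of the first column alone lets it be pulled out of the sum over the remaining permutations. -/
theorem opDet_succ_column_zero {k : ℕ} (A : Matrix (Fin (k + 1)) (Fin (k + 1)) (M → M))
    (A₀ : Fin (k + 1) → M →+ M) (h : ∀ a f, A a 0 f = A₀ a f) (f : M) :
    opDet A f = ∑ a : Fin (k + 1), (-1 : ℤ) ^ (a : ℕ) •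
      A a 0 (opDet (A.submatrix a.succAbove Fin.succ) f) := by
  simp only [opDet, h, map_sum, map_zsmul, Finset.smul_sum]
  rw [Finset.univ_perm_fin_succ, ← Finset.univ_product_univ]
  simp only [Finset.sum_map, Equiv.toEmbedding_apply, Finset.sum_product]
  refine Finset.sum_congr rfl fun i _ => ?_
  refine Fin.cases ?_ (fun i => ?_) i
  · simp [List.ofFn_succ, Equiv.Perm.decomposeFin.symm_sign, h]
  · symm
    -- `decomposeFin` sends 0 to the chosen row by a transposition, which disturbs the order of the
    -- other rows. Composing with this cycle restores the order given by `succAbove`; its sign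
    -- (-1)^i and the -1 of the transposition make up the Laplace sign.
    rw [← Equiv.sum_comp (Equiv.mulLeft (Fin.cycleRange i))]
    refine Finset.sum_congr rfl fun σ _ => ?_
    rw [Equiv.Perm.decomposeFin.symm_sign, if_neg (Fin.succ_ne_zero i), smul_smul]
    congr 1
    · simp only [Equiv.coe_mulLeft, Equiv.Perm.sign_mul, Fin.sign_cycleRange, Fin.val_succ,
        Units.val_mul, Units.val_neg, Units.val_one, Units.val_pow_eq_pow_val, pow_succ]
      have : ((-1 : ℤ) ^ (i : ℕ)) * (-1) ^ (i : ℕ) = 1 := by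
        rw [← mul_pow]; simp
      linear_combination (-(Equiv.Perm.sign σ : ℤ)) * this
    · simp only [List.ofFn_succ, List.foldr_cons, Equiv.coe_mulLeft, Equiv.Perm.mul_apply,
        Fin.succAbove_cycleRange, Equiv.Perm.decomposeFin_symm_apply_zero,
        Equiv.Perm.decomposeFin_symm_apply_succ, h, Matrix.submatrix_apply]

end OpDet

/-! ### Matrices with a distinguished first column -/

section ColMat

variable {A : Type*} {k : ℕ}

/-- The square matrix with first column `u` and the columns of `M` after it. -/
def colMat (u : Fin (k + 1) → A) (M : Matrix (Fin (k + 1)) (Fin k) A) :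
    Matrix (Fin (k + 1)) (Fin (k + 1)) A :=
  Matrix.of fun a => Fin.cons (u a) (M a)

theorem colMat_zero (u : Fin (k + 1) → A) (M : Matrix (Fin (k + 1)) (Fin k) A) (a : Fin (k + 1)) :
    colMat u M a 0 = u a := by simp [colMat]

theorem colMat_succ (u : Fin (k + 1) → A) (M : Matrix (Fin (k + 1)) (Fin k) A) (a : Fin (k + 1))
    (b : Fin k) : colMat u M a b.succ = M a b := by simp [colMat]

theorem colMat_updateCol_zero (u v : Fin (k + 1) → A) (M : Matrix (Fin (k + 1)) (Fin k) A) :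
    (colMat u M).updateCol 0 v = colMat v M := by
  ext a b
  refine Fin.cases ?_ (fun b => ?_) b <;> simp [colMat]

theorem colMat_updateCol_succ (u v : Fin (k + 1) → A) (M : Matrix (Fin (k + 1)) (Fin k) A)
    (l : Fin k) : (colMat u M).updateCol l.succ v = colMat u (M.updateCol l v) := by
  ext a b
  refine Fin.cases ?_ (fun b => ?_) b <;>
    simp [Matrix.updateCol_apply, colMat, (Fin.succ_ne_zero _).symm]

variable [CommRing A]

theorem det_colMat (u : Fin (k + 1) → A) (M : Matrix (Fin (k + 1)) (Fin k) A) :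
    (colMat u M).det =
      ∑ a : Fin (k + 1), (-1) ^ (a : ℕ) * u a * (M.submatrix a.succAbove id).det := by
  rw [Matrix.det_succ_column_zero]
  rfl

theorem det_colMat_sum_left {ι : Type*} (s : Finset ι) (g : ι → A) (u : ι → Fin (k + 1) → A)
    (M : Matrix (Fin (k + 1)) (Fin k) A) :
    (colMat (fun a => ∑ d ∈ s, g d * u d a) M).det = ∑ d ∈ s, g d * (colMat (u d) M).det := by
  simp only [det_colMat, Finset.mul_sum, Finset.sum_mul]
  rw [Finset.sum_comm]
  refine Finset.sum_congr rfl fun d _ => Finset.sum_congr rfl fun a _ => by ring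

theorem det_colMat_right_same (u : Fin (k + 1) → A) (M : Matrix (Fin (k + 1)) (Fin k) A)
    (l : Fin k) : (colMat u (M.updateCol l u)).det = 0 := by
  refine Matrix.det_zero_of_column_eq (i := 0) (j := l.succ) (Fin.succ_ne_zero l).symm fun a => ?_
  simp [colMat]

theorem det_updateCol_linear {ι : Type*} [Fintype ι] [DecidableEq ι] (M : Matrix ι ι A) (l : ι)
    (u v : ι → A) (p q : A) :
    (M.updateCol l fun a => p * u a + q * v a).det =
      p * (M.updateCol l u).det + q * (M.updateCol l v).det := by
  rw [← Matrix.det_updateCol_smul, ← Matrix.det_updateCol_smul, ← Matrix.det_updateCol_add]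
  rfl

theorem det_colMat_right_linear (u v v' : Fin (k + 1) → A) (M : Matrix (Fin (k + 1)) (Fin k) A)
    (l : Fin k) (p q : A) :
    (colMat u (M.updateCol l fun a => p * v a + q * v' a)).det =
      p * (colMat u (M.updateCol l v)).det + q * (colMat u (M.updateCol l v')).det := by
  simp only [← colMat_updateCol_succ, det_updateCol_linear]

/-- Polarization: the determinant with u + v in both columns vanishes, and so do the two terms with
equal columns. -/
theorem det_colMat_swap (u v : Fin (k + 1) → A) (M : Matrix (Fin (k + 1)) (Fin k) A) (l : Fin k) :
    (colMat u (M.updateCol l v)).det = -(colMat v (M.updateCol l u)).det := by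
  have h := det_colMat_right_same (fun a => u a + v a) M l
  have h1 := det_colMat_right_linear (fun a => u a + v a) u v M l 1 1
  -- Additivity in the first column is the case of a sum indexed by `Bool`.
  have h2 := fun w => det_colMat_sum_left (Finset.univ : Finset Bool) (fun _ => 1)
    (fun d => cond d u v) (M.updateCol l w)
  simp only [Fintype.sum_bool, one_mul, cond_true, cond_false] at h1 h2
  rw [h1, h2, h2, det_colMat_right_same, det_colMat_right_same] at h
  linear_combination h

/-- Expansion along the first column, with one of the other columns replaced. -/
theorem sum_mul_det_updateCol (u v : Fin (k + 1) → A) (M : Matrix (Fin (k + 1)) (Fin k) A)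
    (l : Fin k) :
    ∑ a : Fin (k + 1), (-1) ^ (a : ℕ) * (v a *
      ((M.submatrix a.succAbove id).updateCol l fun b => u (a.succAbove b)).det) =
      (colMat v (M.updateCol l u)).det := by
  rw [det_colMat]
  refine Finset.sum_congr rfl fun a _ => ?_
  rw [mul_assoc]
  congr 3

/-- The Leibniz rule, grouped by the column whose entry is differentiated. -/
theorem derivation_det {B : Type*} [CommRing B] [Algebra B A] {ι : Type*} [Fintype ι] [DecidableEq ι] (d : Derivation B A A)
    (M : Matrix ι ι A) :
    d M.det = ∑ l, (M.updateCol l fun a => d (M a l)).det := by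
  have hprod : ∀ (s : Finset ι) (f : ι → A),
      d (∏ i ∈ s, f i) = ∑ l ∈ s, d (f l) * ∏ i ∈ s.erase l, f i := by
    intro s f
    induction s using Finset.induction_on with
    | empty => simp
    | insert a s ha ih =>
      rw [Finset.prod_insert ha, Derivation.leibniz, ih, Finset.sum_insert ha,
        Finset.erase_insert ha, smul_eq_mul, smul_eq_mul, Finset.mul_sum, add_comm]
      congr 1
      · ring
      · refine Finset.sum_congr rfl fun l hl => ?_
        have hne : a ≠ l := fun h => ha (h ▸ hl)
        rw [Finset.erase_insert_of_ne hne, Finset.prod_insert (by simp [ha])]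
        ring
  simp only [Matrix.det_apply, map_sum, Units.smul_def, map_zsmul]
  rw [Finset.sum_comm]
  refine Finset.sum_congr rfl fun σ _ => ?_
  rw [hprod, Finset.smul_sum]
  refine Finset.sum_congr rfl fun l _ => ?_
  rw [← Finset.mul_prod_erase _ _ (Finset.mem_univ l)]
  congr 2
  · simp
  · refine Finset.prod_congr rfl fun i hi => ?_
    simp [Finset.ne_of_mem_erase hi]

end ColMat

/-! ### The action of `∂ ∂ᵀ` on the minors of the inverse Gram matrix -/

section Core

variable {B A : Type*} [CommRing B] [CommRing A] [Algebra B A] {m n : ℕ}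

/-- The operator `∂_{ic}` conjugated by a power of the Gram determinant. -/
def twist (D : Fin m → Fin n → Derivation B A A) (Y : Matrix (Fin m) (Fin n) A) (t : A)
    (i : Fin m) (c : Fin n) : A →+ A where
  toFun f := D i c f + t * Y i c * f
  map_zero' := by simp
  map_add' f g := by simp only [map_add]; ring

theorem twist_apply (D : Fin m → Fin n → Derivation B A A) (Y : Matrix (Fin m) (Fin n) A) (t : A)
    (i : Fin m) (c : Fin n) (f : A) : twist D Y t i c f = D i c f + t * Y i c * f := rfl

theorem twist_mul_of_const {D : Fin m → Fin n → Derivation B A A} {Y : Matrix (Fin m) (Fin n) A}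
    {t : A} {i : Fin m} {c : Fin n} {a : A} (ha : D i c a = 0) (f : A) :
    twist D Y t i c (a * f) = a * twist D Y t i c f := by
  simp only [twist_apply, Derivation.leibniz, ha, smul_eq_mul]
  ring

/-- The cross terms match because t is constant and D_{ic} Y_{jc} is symmetric in i and j, the twist
being a conjugation by a power of P. -/
theorem twist_comm {D : Fin m → Fin n → Derivation B A A} {Y : Matrix (Fin m) (Fin n) A}
    {t : A} (hcomm : ∀ i c j d f, D i c (D j d f) = D j d (D i c f))
    (ht : ∀ i c, D i c t = 0) (hY : ∀ i j c, D i c (Y j c) = D j c (Y i c))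
    (i j : Fin m) (c : Fin n) (f : A) :
    twist D Y t i c (twist D Y t j c f) = twist D Y t j c (twist D Y t i c f) := by
  simp only [twist_apply, Derivation.leibniz, smul_eq_mul, map_add, ht, hcomm i c j c f, hY i j c]
  ring

variable {D : Fin m → Fin n → Derivation B A A} {Y : Matrix (Fin m) (Fin n) A}
  {Q : Matrix (Fin m) (Fin m) A} {t : A}

/-- The term t Y contributes t. Differentiating column l by the formula for ∂Q gives two pieces: one
contributes 1 for each of the k columns, the other vanishes in the alternating sum over a. -/
theorem sum_twist_minor (hYY : ∀ i j, ∑ c, Y i c * Y j c = Q i j)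
    (hQ : ∀ i c j l, D i c (Q j l) = -(Q j i * Y l c + Y j c * Q i l))
    {k : ℕ} (r : Fin (k + 1) → Fin m) (w : Fin k → Fin m) (c : Fin n) :
    ∑ a : Fin (k + 1), (-1) ^ (a : ℕ) *
        twist D Y t (r a) c (Q.submatrix (r ∘ a.succAbove) w).det =
      (t + k) * (colMat (fun a => Y (r a) c) (Q.submatrix r w)).det := by
  set M := Q.submatrix r w with hM
  have hdet : ∀ a : Fin (k + 1), D (r a) c (Q.submatrix (r ∘ a.succAbove) w).det =
      ∑ l : Fin k, (-(Q (r a) (w l) * ((M.submatrix a.succAbove id).updateCol l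
          fun b => Y (r (a.succAbove b)) c).det) -
        Y (w l) c * ∑ d, Y (r a) d * ((M.submatrix a.succAbove id).updateCol l
          fun b => Y (r (a.succAbove b)) d).det) := by
    intro a
    rw [derivation_det]
    refine Finset.sum_congr rfl fun l _ => ?_
    have e1 : (fun b => D (r a) c ((Q.submatrix (r ∘ a.succAbove) w) b l)) =
        fun b => (-Q (r a) (w l)) * Y (r (a.succAbove b)) c +
          (-Y (w l) c) * ∑ d, Y (r a) d * Y (r (a.succAbove b)) d := by
      funext b
      simp only [Matrix.submatrix_apply, Function.comp, hQ]
      rw [← hYY (r (a.succAbove b)) (r a)]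
      simp only [mul_comm (Y (r (a.succAbove b)) _) (Y (r a) _)]
      ring
    have e2 : Q.submatrix (r ∘ a.succAbove) w = M.submatrix a.succAbove id := rfl
    rw [e1, det_updateCol_linear, e2]
    have e3 : ((M.submatrix a.succAbove id).updateCol l
        fun b => ∑ d, Y (r a) d * Y (r (a.succAbove b)) d).det =
        ∑ d, Y (r a) d * ((M.submatrix a.succAbove id).updateCol l
          fun b => Y (r (a.succAbove b)) d).det := by
      -- Cramer's map is linear in the replacement column, so the sum over d comes out.
      simp only [← Matrix.cramer_apply]
      have : (fun b => ∑ d, Y (r a) d * Y (r (a.succAbove b)) d) =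
          ∑ d, Y (r a) d • fun b => Y (r (a.succAbove b)) d := by
        funext b; simp
      rw [this, map_sum]
      simp
    rw [e3]
    ring
  simp only [twist_apply, hdet, mul_add, Finset.sum_add_distrib, Finset.mul_sum, mul_sub,
    Finset.sum_sub_distrib]
  -- Summed over a, the l-th term has column l of `M` in front and Y_{·c} in place l. Swapping the
  -- two cancels the minus sign and restores `M`.
  have s1 : ∑ a : Fin (k + 1), ∑ l : Fin k, (-1 : A) ^ (a : ℕ) *
      -(Q (r a) (w l) * ((M.submatrix a.succAbove id).updateCol l
          fun b => Y (r (a.succAbove b)) c).det) =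
      k * (colMat (fun a => Y (r a) c) M).det := by
    rw [Finset.sum_comm]
    have : ∀ l : Fin k, ∑ a : Fin (k + 1), (-1 : A) ^ (a : ℕ) *
      -(Q (r a) (w l) * ((M.submatrix a.succAbove id).updateCol l
          fun b => Y (r (a.succAbove b)) c).det) = (colMat (fun a => Y (r a) c) M).det := by
      intro l
      simp only [mul_neg, Finset.sum_neg_distrib]
      rw [sum_mul_det_updateCol (fun a => Y (r a) c) (fun a => Q (r a) (w l)) M l,
        det_colMat_swap, neg_neg]
      congr 2
      exact Matrix.updateCol_eq_self M l
    rw [Finset.sum_congr rfl fun l _ => this l]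
    simp
  -- After Q = YYᵀ, each d yields a determinant with Y_{·d} both in front and in place l.
  have s2 : ∑ a : Fin (k + 1), ∑ l : Fin k, ∑ d, (-1 : A) ^ (a : ℕ) *
      (Y (w l) c * (Y (r a) d * ((M.submatrix a.succAbove id).updateCol l
          fun b => Y (r (a.succAbove b)) d).det)) = 0 := by
    rw [Finset.sum_comm]
    refine Finset.sum_eq_zero fun l _ => ?_
    rw [Finset.sum_comm]
    refine Finset.sum_eq_zero fun d _ => ?_
    have := sum_mul_det_updateCol (fun a => Y (r a) d) (fun a => Y (r a) d) M l
    rw [det_colMat_right_same] at this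
    simp only [mul_left_comm _ (Y (w l) c), ← Finset.mul_sum, this, mul_zero]
  rw [s1, s2, det_colMat]
  simp only [sub_zero, Finset.mul_sum]
  rw [← Finset.sum_add_distrib]
  refine Finset.sum_congr rfl fun a _ => ?_
  rw [show M.submatrix a.succAbove id = Q.submatrix (r ∘ a.succAbove) w from rfl]
  ring

/-- The factor has three sources: t from the multiplication term through YYᵀ = Q, n - m - 1 from the
divergence of the first column, and 1 from each of the k columns of Q. -/
theorem sum_twist_colMat (hYY : ∀ i j, ∑ c, Y i c * Y j c = Q i j)
    (hQ : ∀ i c j l, D i c (Q j l) = -(Q j i * Y l c + Y j c * Q i l))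
    (htr : ∀ i j, ∑ c, D j c (Y i c) = ((n : A) - m - 1) * Q i j)
    {k : ℕ} (r : Fin (k + 1) → Fin m) (w : Fin k → Fin m) (j : Fin m) :
    ∑ c, twist D Y t j c (colMat (fun a => Y (r a) c) (Q.submatrix r w)).det =
      (t + n - m - 1 + k) * (colMat (fun a => Q (r a) j) (Q.submatrix r w)).det := by
  set M := Q.submatrix r w with hM
  have hsymm : ∀ i j, Q i j = Q j i := fun i j => by
    rw [← hYY, ← hYY]; exact Finset.sum_congr rfl fun c _ => mul_comm _ _
  have hdet : ∀ c, D j c (colMat (fun a => Y (r a) c) M).det =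
      (colMat (fun a => D j c (Y (r a) c)) M).det +
      ∑ l : Fin k, -(Y (w l) c *
        (colMat (fun a => Y (r a) c) (M.updateCol l fun a => Q (r a) j)).det) := by
    intro c
    rw [derivation_det, Fin.sum_univ_succ]
    simp only [colMat_zero, colMat_succ, colMat_updateCol_zero, colMat_updateCol_succ]
    congr 1
    refine Finset.sum_congr rfl fun l _ => ?_
    have : (fun a => D j c (M a l)) =
        fun a => (-Y (w l) c) * Q (r a) j + (-Q j (w l)) * Y (r a) c := by
      funext a
      simp only [hM, Matrix.submatrix_apply, hQ]
      ring
    -- The part of ∂Q proportional to Y_{·c} repeats the first column and drops out.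
    rw [this, det_colMat_right_linear, det_colMat_right_same]
    ring
  simp only [twist_apply, hdet, Finset.sum_add_distrib]
  have s1 : ∑ c, (colMat (fun a => D j c (Y (r a) c)) M).det =
      ((n : A) - m - 1) * (colMat (fun a => Q (r a) j) M).det := by
    have h1 := det_colMat_sum_left univ (fun _ => (1 : A))
      (fun (c : Fin n) (a : Fin (k + 1)) => D j c (Y (r a) c)) M
    have h2 := det_colMat_sum_left univ (fun _ : Unit => ((n : A) - m - 1))
      (fun _ (a : Fin (k + 1)) => Q (r a) j) M
    simp only [one_mul, htr] at h1
    simp only [univ_unique, sum_singleton] at h2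
    rw [← h1, h2]
  -- Summing over c turns the first column into column `w l` of Q, by YYᵀ = Q. A swap with place l
  -- then puts column j in front and `M` back in order.
  have s2 : ∑ c, ∑ l : Fin k, -(Y (w l) c *
        (colMat (fun a => Y (r a) c) (M.updateCol l fun a => Q (r a) j)).det) =
      k * (colMat (fun a => Q (r a) j) M).det := by
    rw [Finset.sum_comm]
    have : ∀ l : Fin k, ∑ c, -(Y (w l) c *
        (colMat (fun a => Y (r a) c) (M.updateCol l fun a => Q (r a) j)).det) =
        (colMat (fun a => Q (r a) j) M).det := by
      intro l
      rw [Finset.sum_neg_distrib, ← det_colMat_sum_left univ (fun c => Y (w l) c)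
        (fun (c : Fin n) (a : Fin (k + 1)) => Y (r a) c)]
      simp only [hYY]
      rw [det_colMat_swap, neg_neg]
      congr 2
      rw [show (fun a => Q (w l) (r a)) = fun a => M a l from
        funext fun a => by rw [hsymm]; rfl]
      exact Matrix.updateCol_eq_self M l
    simp [this]
  have s3 : ∑ c, t * Y j c * (colMat (fun a => Y (r a) c) M).det =
      t * (colMat (fun a => Q (r a) j) M).det := by
    simp only [mul_assoc, ← Finset.mul_sum]
    rw [← det_colMat_sum_left univ (fun c => Y j c)
        (fun (c : Fin n) (a : Fin (k + 1)) => Y (r a) c)]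
    simp only [hYY, hsymm j]
  rw [s1, s2, s3]
  ring

/-- Minors of `∂ ∂ᵀ`, conjugated by a power of the Gram determinant, applied to `1`. -/
theorem opDet_twist (hcomm : ∀ i c j d f, D i c (D j d f) = D j d (D i c f))
    (ht : ∀ i c, D i c t = 0) (hY : ∀ i j c, D i c (Y j c) = D j c (Y i c))
    (hYY : ∀ i j, ∑ c, Y i c * Y j c = Q i j)
    (hQ : ∀ i c j l, D i c (Q j l) = -(Q j i * Y l c + Y j c * Q i l))
    (htr : ∀ i j, ∑ c, D j c (Y i c) = ((n : A) - m - 1) * Q i j)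
    {k : ℕ} (r w : Fin k → Fin m) :
    opDet ((gramOp fun i c => ⇑(twist D Y t i c)).submatrix r w) 1 =
      (∏ j ∈ range k, (t + j) * (t + n - m - 1 + j)) * (Q.submatrix r w).det := by
  induction k with
  | zero => simp [opDet_zero]
  | succ k ih =>
    -- The constant from the induction hypothesis is killed by every D, so it passes through the
    -- twisted operators.
    have hconst : ∀ (N : ℕ) i c,
        D i c (∏ j ∈ range N, (t + j) * (t + n - m - 1 + j)) = 0 := by
      intro N i c
      induction N with
      | zero => simp
      | succ N ih => rw [prod_range_succ, Derivation.leibniz, ih]; simp [ht]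
    rw [opDet_succ_column_zero _
      (fun a => ∑ c, (twist D Y t (r a) c).comp (twist D Y t (w 0) c))
      (fun a f => by simp [gramOp])]
    have hexp : ∀ a : Fin (k + 1), (((gramOp fun i c => ⇑(twist D Y t i c)).submatrix r w).submatrix
        a.succAbove Fin.succ) = (gramOp fun i c => ⇑(twist D Y t i c)).submatrix
          (r ∘ a.succAbove) (w ∘ Fin.succ) := fun a => rfl
    set κ := ∏ j ∈ range k, (t + j) * (t + n - m - 1 + j) with hκ
    have hterm : ∀ a : Fin (k + 1), ((gramOp fun i c => ⇑(twist D Y t i c)).submatrix r w) a 0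
        (κ * (Q.submatrix (r ∘ a.succAbove) (w ∘ Fin.succ)).det) =
        κ * ∑ c, twist D Y t (w 0) c (twist D Y t (r a) c
          (Q.submatrix (r ∘ a.succAbove) (w ∘ Fin.succ)).det) := by
      intro a
      simp only [Matrix.submatrix_apply, gramOp, Finset.mul_sum]
      refine Finset.sum_congr rfl fun c _ => ?_
      -- The order is exchanged so that T_{r_a,c} meets the minor first and the sum over a can be
      -- taken for fixed c.
      rw [twist_comm hcomm ht hY, twist_mul_of_const (hconst k _ _),
        twist_mul_of_const (hconst k _ _)]
    simp only [hexp, ih, hterm]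
    have h1 : ∀ c, ∑ a : Fin (k + 1), (-1 : ℤ) ^ (a : ℕ) • twist D Y t (w 0) c
        (twist D Y t (r a) c (Q.submatrix (r ∘ a.succAbove) (w ∘ Fin.succ)).det) =
        (t + k) * twist D Y t (w 0) c
          (colMat (fun a => Y (r a) c) (Q.submatrix r (w ∘ Fin.succ))).det := by
      intro c
      rw [← twist_mul_of_const (by simp [ht]), ← sum_twist_minor hYY hQ, map_sum]
      refine Finset.sum_congr rfl fun a _ => ?_
      rw [← map_zsmul, zsmul_eq_mul]
      push_cast
      rfl
    have h2 : (colMat (fun a => Q (r a) (w 0)) (Q.submatrix r (w ∘ Fin.succ))) =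
        Q.submatrix r w := by
      ext a b
      refine Fin.cases ?_ (fun b => ?_) b <;> simp [colMat]
    calc ∑ a : Fin (k + 1), (-1 : ℤ) ^ (a : ℕ) • (κ * ∑ c, twist D Y t (w 0) c
          (twist D Y t (r a) c (Q.submatrix (r ∘ a.succAbove) (w ∘ Fin.succ)).det))
        = κ * ∑ c, ∑ a : Fin (k + 1), (-1 : ℤ) ^ (a : ℕ) • twist D Y t (w 0) c
          (twist D Y t (r a) c (Q.submatrix (r ∘ a.succAbove) (w ∘ Fin.succ)).det) := by
          rw [Finset.sum_comm, Finset.mul_sum]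
          refine Finset.sum_congr rfl fun a _ => ?_
          rw [← Finset.smul_sum, mul_smul_comm]
      _ = _ := by
          simp only [h1, ← Finset.mul_sum]
          rw [sum_twist_colMat hYY hQ htr, h2, prod_range_succ]
          ring

end Core

/-! ### Derivatives of the inverse of a Gram matrix -/

section Gram

variable {B A : Type*} [CommRing B] [CommRing A] [Algebra B A] {m n : ℕ} {D : Fin m → Fin n → Derivation B A A}
  {x : Matrix (Fin m) (Fin n) A}

theorem gram_transpose (x : Matrix (Fin m) (Fin n) A) :
    (x * x.transpose).transpose = x * x.transpose := by
  rw [Matrix.transpose_mul, Matrix.transpose_transpose]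

theorem inv_gram_symm (x : Matrix (Fin m) (Fin n) A) (i j : Fin m) :
    (x * x.transpose)⁻¹ i j = (x * x.transpose)⁻¹ j i := by
  have h := congrFun (congrFun (Matrix.transpose_nonsing_inv (x * x.transpose)) j) i
  rw [gram_transpose] at h
  exact h

theorem sum_pinv_mul_pinv (hP : IsUnit (x * x.transpose).det) (i j : Fin m) :
    ∑ c, ((x * x.transpose)⁻¹ * x) i c * ((x * x.transpose)⁻¹ * x) j c =
      (x * x.transpose)⁻¹ i j := by
  have h : ((x * x.transpose)⁻¹ * x) * ((x * x.transpose)⁻¹ * x).transpose =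
      (x * x.transpose)⁻¹ := by
    rw [Matrix.transpose_mul, Matrix.transpose_nonsing_inv, gram_transpose, Matrix.mul_assoc,
      ← Matrix.mul_assoc x, Matrix.mul_nonsing_inv _ hP, Matrix.mul_one]
  conv_rhs => rw [← h]
  rfl

theorem derivation_gram (hx : ∀ i c j d, D i c (x j d) = if i = j ∧ c = d then 1 else 0)
    (i : Fin m) (c : Fin n) (a b : Fin m) :
    D i c ((x * x.transpose) a b) =
      (if i = a then x b c else 0) + (if i = b then x a c else 0) := by
  simp only [Matrix.mul_apply, Matrix.transpose_apply, map_sum, Derivation.leibniz, hx, smul_eq_mul,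
    mul_ite, mul_one, mul_zero, Finset.sum_add_distrib, ite_and]
  rw [add_comm]
  congr 1 <;> split_ifs <;> simp

/-- Differentiating QG = 1 gives ∂Q = -Q (∂G) Q; each of the two terms of ∂G yields one product of
an entry of Q and an entry of Y. -/
theorem derivation_inv_gram (hx : ∀ i c j d, D i c (x j d) = if i = j ∧ c = d then 1 else 0)
    (hP : IsUnit (x * x.transpose).det) (i : Fin m) (c : Fin n) (j l : Fin m) :
    D i c ((x * x.transpose)⁻¹ j l) =
      -((x * x.transpose)⁻¹ j i * ((x * x.transpose)⁻¹ * x) l c +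
        ((x * x.transpose)⁻¹ * x) j c * (x * x.transpose)⁻¹ i l) := by
  have hG := derivation_gram hx i c
  have hsymm := inv_gram_symm x
  set G := x * x.transpose
  set Q := G⁻¹
  have h1 : Q.map (D i c) * G = -(Q * G.map (D i c)) := by
    ext a b
    have h2 : D i c ((Q * G) a b) = 0 := by
      rw [Matrix.nonsing_inv_mul _ hP, Matrix.one_apply]
      split_ifs <;> simp
    rw [Matrix.mul_apply, map_sum] at h2
    simp only [Derivation.leibniz, smul_eq_mul, Finset.sum_add_distrib] at h2
    rw [Matrix.neg_apply, Matrix.mul_apply, Matrix.mul_apply, eq_neg_iff_add_eq_zero, ← h2,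
      add_comm]
    simp [mul_comm]
  have h3 : Q.map (D i c) = -(Q * G.map (D i c) * Q) := by
    calc Q.map (D i c) = Q.map (D i c) * G * Q := by
          rw [Matrix.mul_assoc, Matrix.mul_nonsing_inv _ hP, Matrix.mul_one]
      _ = _ := by rw [h1, Matrix.neg_mul]
  have h4 := congrFun (congrFun h3 j) l
  rw [Matrix.map_apply] at h4
  rw [h4, Matrix.neg_apply]
  congr 1
  simp only [Matrix.mul_apply, Matrix.map_apply, hG, mul_add, Finset.sum_add_distrib, mul_ite,
    mul_zero, Finset.sum_ite_eq, Finset.mem_univ, if_true, add_mul, Finset.sum_mul, Finset.mul_sum,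
    ite_mul, zero_mul]
  congr 1
  · refine Finset.sum_congr rfl fun b _ => ?_
    rw [hsymm l b]; ring
  · rw [Finset.sum_comm]
    simp [Finset.sum_ite_eq]

theorem derivation_pinv (hx : ∀ i c j d, D i c (x j d) = if i = j ∧ c = d then 1 else 0)
    (hP : IsUnit (x * x.transpose).det) (i : Fin m) (c : Fin n) (j : Fin m) (d : Fin n) :
    D i c (((x * x.transpose)⁻¹ * x) j d) =
      (x * x.transpose)⁻¹ j i * ((if c = d then 1 else 0) -
        ∑ k, ((x * x.transpose)⁻¹ * x) k c * x k d) -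
      ((x * x.transpose)⁻¹ * x) j c * ((x * x.transpose)⁻¹ * x) i d := by
  have hQ := derivation_inv_gram hx hP i c j
  rw [Matrix.mul_apply (N := x) (i := j) (k := d), map_sum]
  rw [Matrix.mul_apply (N := x) (i := i) (k := d)]
  simp only [Derivation.leibniz, smul_eq_mul, hQ, hx, Finset.sum_add_distrib, mul_ite, mul_one,
    mul_zero, mul_sub, Finset.mul_sum, ite_and, Finset.sum_ite_eq, Finset.mem_univ, if_true]
  rw [sub_sub, sub_eq_add_neg, ← Finset.sum_add_distrib, ← Finset.sum_neg_distrib]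
  congr 1
  refine Finset.sum_congr rfl fun k _ => by ring

/-- The source of n - m - 1: the trace of the identity minus the projection XᵀQX is n - m, and ∑_c
Y_{ic} Y_{jc} = Q_{ij} takes away one more. -/
theorem sum_derivation_pinv (hx : ∀ i c j d, D i c (x j d) = if i = j ∧ c = d then 1 else 0)
    (hP : IsUnit (x * x.transpose).det) (i j : Fin m) :
    ∑ c, D j c (((x * x.transpose)⁻¹ * x) i c) =
      ((n : A) - m - 1) * (x * x.transpose)⁻¹ i j := by
  have htr : ∑ c, ∑ k, ((x * x.transpose)⁻¹ * x) k c * x k c = (m : A) := by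
    rw [Finset.sum_comm]
    have : ∀ k, ∑ c, ((x * x.transpose)⁻¹ * x) k c * x k c =
        (((x * x.transpose)⁻¹ * x) * x.transpose) k k := fun k => rfl
    simp only [this, Matrix.mul_assoc, Matrix.nonsing_inv_mul _ hP, Matrix.one_apply_eq]
    simp
  simp only [derivation_pinv hx hP, if_true, Finset.sum_sub_distrib, ← Finset.mul_sum, htr,
    sum_pinv_mul_pinv hP]
  simp
  ring

/-- Formally Y is half the gradient of log P, so this is equality of mixed second derivatives. The
explicit formula avoids dividing by 2. -/
theorem derivation_pinv_symm (hx : ∀ i c j d, D i c (x j d) = if i = j ∧ c = d then 1 else 0)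
    (hP : IsUnit (x * x.transpose).det) (i j : Fin m) (c : Fin n) :
    D i c (((x * x.transpose)⁻¹ * x) j c) = D j c (((x * x.transpose)⁻¹ * x) i c) := by
  rw [derivation_pinv hx hP, derivation_pinv hx hP, inv_gram_symm x j i]
  ring

/-- Jacobi's formula for the derivative of a determinant, with adjugate PQ. The two terms of ∂G
contribute equally by symmetry, whence the 2. -/
theorem derivation_det_gram (hx : ∀ i c j d, D i c (x j d) = if i = j ∧ c = d then 1 else 0)
    (hP : IsUnit (x * x.transpose).det) (i : Fin m) (c : Fin n) :
    D i c (x * x.transpose).det =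
      2 * ((x * x.transpose)⁻¹ * x) i c * (x * x.transpose).det := by
  have hG := derivation_gram hx i c
  have hsymm := inv_gram_symm x
  have hadj : ∀ a b, (x * x.transpose).adjugate a b =
      (x * x.transpose).det * (x * x.transpose)⁻¹ a b := by
    intro a b
    rw [Matrix.inv_def, Matrix.smul_apply, smul_eq_mul, ← mul_assoc, Ring.mul_inverse_cancel _ hP,
      one_mul]
  rw [derivation_det]
  simp only [← Matrix.cramer_apply, Matrix.cramer_eq_adjugate_mulVec, Matrix.mulVec, dotProduct,
    hadj, hG, mul_add, mul_ite, mul_zero, Finset.sum_add_distrib, Finset.sum_ite_eq,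
    Finset.mem_univ, if_true]
  rw [Finset.sum_comm (f := fun l a => if i = l then _ else _)]
  simp only [Finset.sum_ite_eq, Finset.mem_univ, if_true, Matrix.mul_apply (N := x), hsymm _ i,
    Finset.mul_sum, Finset.sum_mul, ← Finset.sum_add_distrib]
  refine Finset.sum_congr rfl fun a _ => by ring

/-- The Cayley identity in a differential ring, for the twisted derivations
`f ↦ ∂f + s (∂P) P⁻¹ f`. -/
theorem opDet_twist_gram (hcomm : ∀ i c j d f, D i c (D j d f) = D j d (D i c f))
    (hx : ∀ i c j d, D i c (x j d) = if i = j ∧ c = d then 1 else 0)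
    (hP : IsUnit (x * x.transpose).det) {s : A} (hs : ∀ i c, D i c s = 0)
    {k : ℕ} (r w : Fin k → Fin m) :
    opDet ((gramOp fun i c => ⇑(twist D ((x * x.transpose)⁻¹ * x) (2 * s) i c)).submatrix r w) 1 =
      coeff m n k s * ((x * x.transpose)⁻¹.submatrix r w).det := by
  have h2 : ∀ i c, D i c (2 * s) = 0 := fun i c => by
    rw [two_mul, map_add, hs, add_zero]
  exact opDet_twist hcomm h2 (derivation_pinv_symm hx hP) (sum_pinv_mul_pinv hP)
    (derivation_inv_gram hx hP) (sum_derivation_pinv hx hP) r w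

end Gram

/-! ### Complementary minors of the inverse matrix -/

section Jacobi

variable {m k : ℕ}

theorem prod_ite_lt_val {N : ℕ} (x : Fin N) :
    (∏ y : Fin N, if y < x then (-1 : ℤ) else 1) = (-1) ^ (x : ℕ) := by
  rw [Finset.prod_ite, Finset.prod_const_one, mul_one, Finset.prod_const]
  congr 1
  rw [← Fin.card_Iio x]
  congr 1
  ext y; simp

/-- The permutation that lists `I` in increasing order, then its complement. -/
def shuffle {I : Finset (Fin m)} (hI : I.card = k) (h : k + (m - k) = m) :
    Equiv.Perm (Fin m) :=
  (finSumFinEquiv.trans (finCongr h)).symm.trans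
    (finSumEquivOfFinset hI (card_compl_of_card hI))

theorem sign_shuffle {I : Finset (Fin m)} (hI : I.card = k) (h : k + (m - k) = m) :
    (Equiv.Perm.sign (shuffle hI h) : ℤ) =
      ∏ a : Fin k, ((-1) ^ (I.orderEmbOfFin hI a : ℕ) * (-1) ^ (a : ℕ)) := by
  set hc := card_compl_of_card hI
  set e := finSumEquivOfFinset hI hc with he
  set τ : Fin k ⊕ Fin (m - k) ≃ Fin m := finSumFinEquiv.trans (finCongr h) with hτ
  have hσ : ∀ z, shuffle hI h (τ z) = e z := fun z => by simp [shuffle, he, hτ]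
  have hll : ∀ a a' : Fin k, τ (Sum.inl a) < τ (Sum.inl a') ↔ a < a' := fun a a' => by
    rw [Fin.lt_def, Fin.lt_def]; simp [hτ]
  have hrr : ∀ a a' : Fin (m - k), τ (Sum.inr a) < τ (Sum.inr a') ↔ a < a' := fun a a' => by
    rw [Fin.lt_def, Fin.lt_def]; simp [hτ]
  have hlr : ∀ (a : Fin k) (b : Fin (m - k)), τ (Sum.inl a) < τ (Sum.inr b) := fun a b => by
    rw [Fin.lt_def]; simp only [hτ, Equiv.trans_apply, finSumFinEquiv_apply_left,
      finSumFinEquiv_apply_right, finCongr_apply_coe, Fin.val_castAdd, Fin.val_natAdd]; omega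
  -- Only pairs formed by an element of I and a smaller element of its complement are inversions, as
  -- both blocks are listed in increasing order.
  have h1 : (Equiv.Perm.sign (shuffle hI h) : ℤ) =
      ∏ a : Fin k, ∏ b : Fin (m - k),
        if Iᶜ.orderEmbOfFin hc b < I.orderEmbOfFin hI a then (-1 : ℤ) else 1 := by
    rw [Equiv.Perm.sign_eq_prod_prod_Iio]
    have : ∀ j : Fin m, (∏ i ∈ Finset.Iio j,
        if shuffle hI h i < shuffle hI h j then (1 : ℤˣ) else -1) =
        ∏ z, if τ z < j then (if e z < shuffle hI h j then (1 : ℤˣ) else -1) else 1 := by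
      intro j
      trans ∏ i, if i < j then (if shuffle hI h i < shuffle hI h j then (1 : ℤˣ) else -1) else 1
      · rw [← Finset.prod_filter]
        congr 1
        ext y; simp
      · rw [← Equiv.prod_comp τ]
        simp only [hσ]
    simp only [this]
    rw [← Equiv.prod_comp τ]
    simp only [hσ, Fintype.prod_sum_type]
    simp only [hll, hrr, hlr, (hlr _ _).not_gt, if_true, if_false, he, finSumEquivOfFinset_inl,
      finSumEquivOfFinset_inr, OrderEmbedding.lt_iff_lt]
    have t : ∀ {N : ℕ} (a b : Fin N), (if a < b then (if a < b then (1 : ℤˣ) else -1) else 1) = 1 :=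
      fun a b => by split_ifs <;> rfl
    simp only [t, Finset.prod_const_one, one_mul, mul_one]
    rw [Finset.prod_comm]
    push_cast
    refine Finset.prod_congr rfl fun a _ => Finset.prod_congr rfl fun b _ => ?_
    have hne : I.orderEmbOfFin hI a ≠ Iᶜ.orderEmbOfFin hc b := by
      intro hab
      have h1 := Finset.orderEmbOfFin_mem I hI a
      have h2 := Finset.orderEmbOfFin_mem Iᶜ hc b
      rw [← hab, Finset.mem_compl] at h2
      exact h2 h1
    rcases lt_or_gt_of_ne hne with hlt | hlt
    · simp [hlt, hlt.not_gt]
    · simp [hlt, hlt.not_gt]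
  rw [h1]
  refine Finset.prod_congr rfl fun a _ => ?_
  -- The elements below the a-th element of I, counted from 0, are a elements of I and the
  -- complement elements being counted.
  rw [← prod_ite_lt_val (I.orderEmbOfFin hI a), ← prod_ite_lt_val a, ← Equiv.prod_comp e,
    Fintype.prod_sum_type]
  simp only [he, finSumEquivOfFinset_inl, finSumEquivOfFinset_inr, OrderEmbedding.lt_iff_lt]
  rw [prod_ite_lt_val a, mul_right_comm, ← mul_pow]
  simp

theorem sign_shuffle_mul {I J : Finset (Fin m)} (hI : I.card = k) (hJ : J.card = k)
    (h : k + (m - k) = m) :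
    (Equiv.Perm.sign (shuffle hI h) : ℤ) * Equiv.Perm.sign (shuffle hJ h) = eps I J := by
  have hsum : ∀ {I : Finset (Fin m)} (hI : I.card = k),
      (-1 : ℤ) ^ (∑ i ∈ I, (i.val + 1)) = ∏ a : Fin k, (-1) ^ ((I.orderEmbOfFin hI a : ℕ) + 1) := by
    intro I hI
    rw [Finset.prod_pow_eq_pow_sum]
    congr 1
    conv_lhs => rw [← Finset.map_orderEmbOfFin_univ I hI, Finset.sum_map]
    rfl
  rw [eps, pow_add, hsum hI, hsum hJ, sign_shuffle, sign_shuffle, ← Finset.prod_mul_distrib,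
    ← Finset.prod_mul_distrib]
  refine Finset.prod_congr rfl fun a _ => ?_
  have : ((-1 : ℤ) ^ (a : ℕ)) * (-1) ^ (a : ℕ) = 1 := by
    rw [← mul_pow]; simp
  rw [pow_succ, pow_succ]
  linear_combination
    ((-1) ^ (I.orderEmbOfFin hI a : ℕ) * (-1) ^ (J.orderEmbOfFin hJ a : ℕ)) * this

theorem complMinor_transpose {R : Type*} [CommRing R] (G : Matrix (Fin m) (Fin m) R)
    {I J : Finset (Fin m)} (hI : I.card = k) (hJ : J.card = k) :
    complMinor G.transpose hI hJ = complMinor G hJ hI := by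
  rw [complMinor, complMinor, ← Matrix.det_transpose]
  rfl

theorem complMinor_map {R R' : Type*} [CommRing R] [CommRing R'] (φ : R →+* R')
    (G : Matrix (Fin m) (Fin m) R) {I J : Finset (Fin m)} (hI : I.card = k) (hJ : J.card = k) :
    complMinor (G.map φ) hI hJ = φ (complMinor G hI hJ) := by
  rw [complMinor, complMinor, RingHom.map_det]
  rfl

/-- Jacobi's identity for the minors of the inverse matrix. -/
theorem det_sub_inv_mul_det {R : Type*} [CommRing R] (G : Matrix (Fin m) (Fin m) R)
    (hG : IsUnit G.det) {I J : Finset (Fin m)} (hI : I.card = k) (hJ : J.card = k) :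
    (sub G⁻¹ hI hJ).det * G.det = (eps I J : ℤ) * complMinor G hJ hI := by
  have h : k + (m - k) = m := by
    have := Finset.card_le_univ I
    rw [Fintype.card_fin] at this
    omega
  have hcI := card_compl_of_card hI
  have hcJ := card_compl_of_card hJ
  set eI := finSumEquivOfFinset hI hcI with heI
  set eJ := finSumEquivOfFinset hJ hcJ with heJ
  have hGQ : (G.submatrix eJ eI) * (G⁻¹.submatrix eI eJ) = 1 := by
    rw [Matrix.submatrix_mul_equiv, Matrix.mul_nonsing_inv _ hG, Matrix.submatrix_one_equiv]
  have hdet : (G.submatrix eJ eI).det = (eps I J : ℤ) * G.det := by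
    have h1 : G.submatrix eJ eI =
        (G.submatrix (eI.symm.trans eJ) id).submatrix eI eI := by
      ext a b; simp
    have h2 : (eI.symm.trans eJ : Equiv.Perm (Fin m)) = shuffle hJ h * (shuffle hI h)⁻¹ := by
      ext a
      simp [shuffle, heI, heJ, Equiv.Perm.mul_def, Equiv.Perm.inv_def]
    rw [h1, Matrix.det_submatrix_equiv_self, Matrix.det_permute, h2, ← sign_shuffle_mul hI hJ h,
      Equiv.Perm.sign_mul, Equiv.Perm.sign_inv]
    push_cast
    ring
  have hsq : ((eps I J : ℤ) : R) * (eps I J : ℤ) = 1 := by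
    rw [← Int.cast_mul, eps, ← mul_pow]; simp
  set G' := G.submatrix eJ eI
  set Q' := G⁻¹.submatrix eI eJ
  -- The first block column of Q' is sent to that of the identity, since G'Q' = 1; the second block
  -- column of the identity just copies that of G'. Taking determinants gives det G' · det Q'₁₁ =
  -- det G'₂₂.
  have hprod : G' * Matrix.fromBlocks Q'.toBlocks₁₁ 0 Q'.toBlocks₂₁ 1 =
      Matrix.fromBlocks 1 G'.toBlocks₁₂ 0 G'.toBlocks₂₂ := by
    rw [← Matrix.fromBlocks_toBlocks G', ← Matrix.fromBlocks_toBlocks Q',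
      Matrix.fromBlocks_multiply, ← Matrix.fromBlocks_one, Matrix.fromBlocks_inj] at hGQ
    conv_lhs => rw [← Matrix.fromBlocks_toBlocks G']
    rw [Matrix.fromBlocks_multiply]
    simp [hGQ.1, hGQ.2.2.1]
  have hd := congrArg Matrix.det hprod
  rw [Matrix.det_mul, Matrix.det_fromBlocks_zero₁₂, Matrix.det_fromBlocks_zero₂₁, Matrix.det_one,
    Matrix.det_one, mul_one, one_mul, hdet] at hd
  have e1 : Q'.toBlocks₁₁ = sub G⁻¹ hI hJ := by
    ext a b
    simp [Q', sub, Matrix.toBlocks₁₁, heI, heJ]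
  have e2 : G'.toBlocks₂₂ = sub G hcJ hcI := by
    ext a b
    simp [G', sub, Matrix.toBlocks₂₂, heI, heJ]
  rw [e1, e2] at hd
  rw [complMinor, ← hd]
  linear_combination (-(sub G⁻¹ hI hJ).det * G.det) * hsq

end Jacobi

/-! ### Derivations of localizations -/

section Loc

variable {R A : Type*} [CommRing R] [CommRing A] [Algebra R A]

theorem locD_add (S : Submonoid A) (d : Derivation R A A) (f g : Localization S) :
    locD S d (f + g) = locD S d f + locD S d g := by
  obtain ⟨a, b, rfl⟩ := IsLocalization.exists_mk'_eq S f
  obtain ⟨c, e, rfl⟩ := IsLocalization.exists_mk'_eq S g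
  rw [← IsLocalization.mk'_add, locD_mk', locD_mk', locD_mk', ← IsLocalization.mk'_add]
  refine IsLocalization.mk'_eq_of_eq ?_
  simp only [Submonoid.coe_mul, map_add, Derivation.leibniz, smul_eq_mul]
  ring

theorem locD_mul (S : Submonoid A) (d : Derivation R A A) (f g : Localization S) :
    locD S d (f * g) = f * locD S d g + g * locD S d f := by
  obtain ⟨a, b, rfl⟩ := IsLocalization.exists_mk'_eq S f
  obtain ⟨c, e, rfl⟩ := IsLocalization.exists_mk'_eq S g
  rw [← IsLocalization.mk'_mul, locD_mk', locD_mk', locD_mk', ← IsLocalization.mk'_mul,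
    ← IsLocalization.mk'_mul, ← IsLocalization.mk'_add]
  refine IsLocalization.mk'_eq_of_eq ?_
  simp only [Submonoid.coe_mul, Derivation.leibniz, smul_eq_mul]
  ring

theorem locD_algebraMap (S : Submonoid A) (d : Derivation R A A) (a : A) :
    locD S d (algebraMap A (Localization S) a) = algebraMap A (Localization S) (d a) := by
  rw [← IsLocalization.mk'_one (M := S), locD_mk', ← IsLocalization.mk'_one (M := S)]
  simp

/-- The map `locD S d` as a derivation. -/
def locDer (S : Submonoid A) (d : Derivation R A A) :
    Derivation R (Localization S) (Localization S) :=
  Derivation.mk'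
    { toFun := locD S d
      map_add' := locD_add S d
      map_smul' := fun r f => by
        rw [Algebra.smul_def, IsScalarTower.algebraMap_apply R A, locD_mul, locD_algebraMap,
          Derivation.map_algebraMap, map_zero, mul_zero, add_zero, RingHom.id_apply,
          Algebra.smul_def, ← IsScalarTower.algebraMap_apply R A] } (locD_mul S d)

theorem locDer_apply (S : Submonoid A) (d : Derivation R A A) (f : Localization S) :
    locDer S d f = locD S d f := rfl

theorem locDer_algebraMap (S : Submonoid A) (d : Derivation R A A) (a : A) :
    locDer S d (algebraMap A (Localization S) a) = algebraMap A (Localization S) (d a) :=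
  locD_algebraMap S d a

theorem locDer_comm (S : Submonoid A) (d d' : Derivation R A A)
    (h : ∀ a, d (d' a) = d' (d a)) (f : Localization S) :
    locDer S d (locDer S d' f) = locDer S d' (locDer S d f) := by
  obtain ⟨a, b, rfl⟩ := IsLocalization.exists_mk'_eq S f
  set f := IsLocalization.mk' (Localization S) a b
  have hf : f * algebraMap A _ (b : A) = algebraMap A _ a := IsLocalization.mk'_spec _ a b
  have h1 := congrArg (fun g => locDer S d (locDer S d' g)) hf
  have h2 := congrArg (fun g => locDer S d' (locDer S d g)) hf
  simp only [Derivation.leibniz, smul_eq_mul, map_add, locDer_algebraMap] at h1 h2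
  rw [h a] at h1
  rw [h b] at h1
  -- Apply both composites to f b = a. The cross terms agree and the composites agree on a and b, so
  -- b times the difference on f is 0, and b is a unit.
  refine (IsLocalization.map_units (Localization S) b).mul_left_cancel ?_
  linear_combination h1 - h2

end Loc

/-! ### The matrix of indeterminates in a localization, and transfer along homomorphisms. -/

theorem pderiv_comm {σ R : Type*} [CommRing R] (i j : σ) (f : MvPolynomial σ R) :
    MvPolynomial.pderiv i (MvPolynomial.pderiv j f) =
      MvPolynomial.pderiv j (MvPolynomial.pderiv i f) := by
  classical
  -- The commutator is a derivation, so it suffices that it kills the variables.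
  have h : ⁅(MvPolynomial.pderiv i : Derivation R (MvPolynomial σ R) (MvPolynomial σ R)),
      (MvPolynomial.pderiv j : Derivation R (MvPolynomial σ R) (MvPolynomial σ R))⁆ = 0 := by
    refine MvPolynomial.derivation_ext fun l => ?_
    rw [Derivation.commutator_apply]
    simp only [MvPolynomial.pderiv_X, Pi.single_apply]
    split_ifs <;> simp
  have h2 := congrArg (fun D => D f) h
  rw [Derivation.commutator_apply] at h2
  simpa [sub_eq_zero] using h2

section GenericGram

variable {m n : ℕ} {R : Type*} [CommRing R]

/-- The image of the matrix of indeterminates in a localization. -/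
def locMat (m n : ℕ) {R : Type*} [CommRing R] (S : Submonoid (MvPolynomial (Fin m × Fin n) R)) :
    Matrix (Fin m) (Fin n) (Localization S) :=
  (genMat m n R).map (algebraMap _ _)

theorem locMat_mul_transpose (S : Submonoid (MvPolynomial (Fin m × Fin n) R)) :
    locMat m n S * (locMat m n S).transpose =
      (genGram m n R).map (algebraMap (MvPolynomial (Fin m × Fin n) R) (Localization S)) := by
  rw [genGram, Matrix.map_mul, locMat, Matrix.transpose_map]

theorem det_locMat (S : Submonoid (MvPolynomial (Fin m × Fin n) R)) :
    (locMat m n S * (locMat m n S).transpose).det =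
      algebraMap (MvPolynomial (Fin m × Fin n) R) (Localization S) (genGram m n R).det := by
  rw [locMat_mul_transpose, RingHom.map_det]
  rfl

theorem locDer_locMat (S : Submonoid (MvPolynomial (Fin m × Fin n) R)) (i : Fin m) (c : Fin n)
    (j : Fin m) (d : Fin n) :
    locDer S (MvPolynomial.pderiv (i, c)) (locMat m n S j d) =
      if i = j ∧ c = d then 1 else 0 := by
  rw [locMat, Matrix.map_apply, locDer_algebraMap, genMat, MvPolynomial.pderiv_X, Pi.single_apply]
  have : ((j, d) = (i, c)) ↔ (i = j ∧ c = d) := by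
    rw [Prod.mk.injEq, eq_comm, @eq_comm _ d]
  simp only [this]
  split_ifs <;> simp

theorem locDer_det_gram (S : Submonoid (MvPolynomial (Fin m × Fin n) R))
    (hP : IsUnit (algebraMap (MvPolynomial (Fin m × Fin n) R) (Localization S)
      (genGram m n R).det)) (i : Fin m) (c : Fin n) :
    locDer S (MvPolynomial.pderiv (i, c))
        (algebraMap (MvPolynomial (Fin m × Fin n) R) (Localization S) (genGram m n R).det) =
      2 * ((locMat m n S * (locMat m n S).transpose)⁻¹ * locMat m n S) i c *
        algebraMap (MvPolynomial (Fin m × Fin n) R) (Localization S) (genGram m n R).det := by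
  rw [← det_locMat] at hP ⊢
  exact derivation_det_gram (D := fun i c => locDer S (MvPolynomial.pderiv (i, c)))
    (locDer_locMat S) hP i c

theorem opDet_twist_loc (S : Submonoid (MvPolynomial (Fin m × Fin n) R))
    (hP : IsUnit (algebraMap (MvPolynomial (Fin m × Fin n) R) (Localization S)
      (genGram m n R).det)) {s : Localization S}
    (hs : ∀ i c, locDer S (MvPolynomial.pderiv (i, c)) s = 0)
    {k : ℕ} (r w : Fin k → Fin m) :
    opDet ((gramOp fun i c => ⇑(twist (fun i c => locDer S (MvPolynomial.pderiv (i, c)))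
        ((locMat m n S * (locMat m n S).transpose)⁻¹ * locMat m n S) (2 * s) i c)).submatrix r w)
        1 =
      coeff m n k s * ((locMat m n S * (locMat m n S).transpose)⁻¹.submatrix r w).det := by
  rw [← det_locMat] at hP
  exact opDet_twist_gram (fun i c j d f => locDer_comm S _ _ (pderiv_comm _ _) f)
    (locDer_locMat S) hP hs r w

theorem det_inv_locMat_mul (S : Submonoid (MvPolynomial (Fin m × Fin n) R))
    (hP : IsUnit (algebraMap (MvPolynomial (Fin m × Fin n) R) (Localization S)
      (genGram m n R).det)) :
    (locMat m n S * (locMat m n S).transpose)⁻¹.det *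
      algebraMap (MvPolynomial (Fin m × Fin n) R) (Localization S) (genGram m n R).det = 1 := by
  rw [← det_locMat] at hP ⊢
  exact Matrix.det_nonsing_inv_mul_det _ hP

theorem det_sub_inv_locMat_mul (S : Submonoid (MvPolynomial (Fin m × Fin n) R))
    (hP : IsUnit (algebraMap (MvPolynomial (Fin m × Fin n) R) (Localization S)
      (genGram m n R).det)) {k : ℕ} {I J : Finset (Fin m)} (hI : I.card = k) (hJ : J.card = k) :
    (sub (locMat m n S * (locMat m n S).transpose)⁻¹ hI hJ).det *
      algebraMap (MvPolynomial (Fin m × Fin n) R) (Localization S) (genGram m n R).det =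
      (eps I J : ℤ) * algebraMap (MvPolynomial (Fin m × Fin n) R) (Localization S)
        (complMinor (genGram m n R) hI hJ) := by
  rw [← det_locMat] at hP ⊢
  rw [det_sub_inv_mul_det _ hP, ← complMinor_transpose, gram_transpose, locMat_mul_transpose,
    complMinor_map]

end GenericGram

/-- At the rectangular identity matrix, available because m ≤ n, the Gram matrix is the identity. -/
theorem det_genGram_ne_zero {m n : ℕ} (hmn : m ≤ n) (R : Type*) [CommRing R] [Nontrivial R] :
    (genGram m n R).det ≠ 0 := by
  intro h
  have h1 := congrArg (MvPolynomial.eval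
    (fun p : Fin m × Fin n => if (p.1 : ℕ) = p.2 then (1 : R) else 0)) h
  rw [RingHom.map_det, map_zero] at h1
  have h2 : (MvPolynomial.eval
    (fun p : Fin m × Fin n => if (p.1 : ℕ) = p.2 then (1 : R) else 0)).mapMatrix (genGram m n R) =
      1 := by
    ext i j
    simp only [RingHom.mapMatrix_apply, Matrix.map_apply, genGram, genMat, Matrix.mul_apply,
      Matrix.transpose_apply, map_sum, map_mul, MvPolynomial.eval_X]
    rw [Finset.sum_eq_single (Fin.castLE hmn i)]
    · simp [Matrix.one_apply, Fin.ext_iff, eq_comm]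
    · intro c _ hc
      rw [if_neg, zero_mul]
      intro h; exact hc (Fin.ext h.symm)
    · simp
  rw [h2, Matrix.det_one] at h1
  exact one_ne_zero h1

theorem opDet_gramOp_map {M M' : Type*} [AddCommGroup M] [AddCommGroup M'] {m n k : ℕ}
    {D : Fin m → Fin n → M → M} {D' : Fin m → Fin n → M' → M'} (Φ : M →+ M')
    (h : ∀ i c f, D' i c (Φ f) = Φ (D i c f)) (r w : Fin k → Fin m) (f : M) :
    opDet ((gramOp D').submatrix r w) (Φ f) = Φ (opDet ((gramOp D).submatrix r w) f) := by
  have hD : ∀ i c f g, (f, g) ∈ Φ.graph → (D i c f, D' i c g) ∈ Φ.graph := by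
    intro i c f g hfg
    rw [AddMonoidHom.mem_graph] at hfg ⊢
    exact (h i c f ▸ congrArg (D' i c) hfg :)
  have := opDet_mem (A := (gramOp D).submatrix r w) (A' := (gramOp D').submatrix r w) Φ.graph
    (fun a b f g hfg => gramOp_mem Φ.graph hD _ _ f g hfg) (f := f) (g := Φ f)
    (AddMonoidHom.mem_graph.2 rfl)
  exact (AddMonoidHom.mem_graph.1 this).symm

theorem map_coeff {R R' : Type*} [CommRing R] [CommRing R'] (φ : R →+* R') (m n k : ℕ) (s : R) :
    φ (coeff m n k s) = coeff m n k (φ s) := by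
  simp only [coeff, map_prod, map_mul, map_add, map_sub, map_natCast, map_one, map_ofNat]

/-! ### Rational fractions -/

section Rat

variable {m n : ℕ}

theorem opDet_ratD (hmn : m ≤ n) (K : Type*) [Field K] (s : ℤ) {k : ℕ} (r w : Fin k → Fin m) :
    opDet ((gramOp (ratD m n K)).submatrix r w) (toRat (genGram m n K).det ^ s) =
      coeff m n k (s : FractionRing (MvPolynomial (Fin m × Fin n) K)) *
        ((locMat m n (nonZeroDivisors (MvPolynomial (Fin m × Fin n) K)) *
          (locMat m n (nonZeroDivisors (MvPolynomial (Fin m × Fin n) K))).transpose)⁻¹.submatrix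
            r w).det * toRat (genGram m n K).det ^ s := by
  have hP0 : toRat (genGram m n K).det ≠ 0 := by
    rw [toRat, Ne, FaithfulSMul.algebraMap_eq_zero_iff]
    exact det_genGram_ne_zero hmn K
  have hP : IsUnit (toRat (genGram m n K).det) := isUnit_iff_ne_zero.2 hP0
  rw [← opDet_twist_loc (nonZeroDivisors (MvPolynomial (Fin m × Fin n) K)) hP
    (fun i c => Derivation.map_intCast _ s) r w]
  -- Multiplication by P^s intertwines the twisted derivations with ∂ and sends 1 to P^s.
  have key := opDet_gramOp_map (D' := ratD m n K)
    (D := fun i c => ⇑(twist (fun i c => locDer (nonZeroDivisors (MvPolynomial (Fin m × Fin n) K))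
      (MvPolynomial.pderiv (i, c))) ((locMat m n (nonZeroDivisors (MvPolynomial (Fin m × Fin n) K)) *
        (locMat m n (nonZeroDivisors (MvPolynomial (Fin m × Fin n) K))).transpose)⁻¹ *
        locMat m n (nonZeroDivisors (MvPolynomial (Fin m × Fin n) K)))
      (2 * (s : FractionRing (MvPolynomial (Fin m × Fin n) K))) i c))
    (AddMonoidHom.mulRight (toRat (genGram m n K).det ^ s)) ?_ r w 1
  · simpa only [AddMonoidHom.coe_mulRight, one_mul] using key
  · intro i c f
    have h1 := locDer_det_gram (nonZeroDivisors (MvPolynomial (Fin m × Fin n) K)) hP i c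
    have h2 := Derivation.leibniz_zpow (locDer (nonZeroDivisors (MvPolynomial (Fin m × Fin n) K))
      (MvPolynomial.pderiv (i, c))) (toRat (genGram m n K).det) s
    rw [AddMonoidHom.mulRight_apply, AddMonoidHom.mulRight_apply, ratD, ← locDer_apply,
      Derivation.leibniz, h2, twist_apply]
    change locDer _ _ (toRat _) = _ * toRat _ at h1
    rw [h1]
    simp only [smul_eq_mul, zsmul_eq_mul]
    rw [zpow_sub_one₀ hP0]
    field_simp
    ring

theorem rat_identity (hmn : m ≤ n) (K : Type*) [Field K] (s : ℤ) :
      opDet (gramOp (ratD m n K)) (toRat (genGram m n K).det ^ s) =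
        coeff m n m (s : FractionRing (MvPolynomial (Fin m × Fin n) K)) *
          toRat (genGram m n K).det ^ (s - 1) ∧
      ∀ (k : ℕ) (I J : Finset (Fin m)) (hI : I.card = k) (hJ : J.card = k),
        opDet (sub (gramOp (ratD m n K)) hI hJ) (toRat (genGram m n K).det ^ s) =
          coeff m n k (s : FractionRing (MvPolynomial (Fin m × Fin n) K)) *
            toRat (genGram m n K).det ^ (s - 1) *
            ((eps I J : ℤ) * toRat (complMinor (genGram m n K) hI hJ)) := by
  have hP0 : toRat (genGram m n K).det ≠ 0 := by
    rw [toRat, Ne, FaithfulSMul.algebraMap_eq_zero_iff]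
    exact det_genGram_ne_zero hmn K
  have hs : toRat (genGram m n K).det ^ s =
      toRat (genGram m n K).det * toRat (genGram m n K).det ^ (s - 1) := by
    rw [mul_comm, zpow_sub_one₀ hP0]; field_simp
  refine ⟨?_, fun k I J hI hJ => ?_⟩
  · have h := opDet_ratD hmn K s (id : Fin m → Fin m) id
    have hd := det_inv_locMat_mul (nonZeroDivisors (MvPolynomial (Fin m × Fin n) K))
      (isUnit_iff_ne_zero.2 hP0)
    rw [Matrix.submatrix_id_id, Matrix.submatrix_id_id] at h
    rw [h, hs]
    change _ * toRat _ = _ at hd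
    linear_combination (coeff m n m (s : FractionRing (MvPolynomial (Fin m × Fin n) K)) *
      toRat (genGram m n K).det ^ (s - 1)) * hd
  · have h := opDet_ratD hmn K s (I.orderEmbOfFin hI) (J.orderEmbOfFin hJ)
    have hd := det_sub_inv_locMat_mul (nonZeroDivisors (MvPolynomial (Fin m × Fin n) K))
      (isUnit_iff_ne_zero.2 hP0) hI hJ
    rw [sub, h, hs]
    change _ * toRat _ = _ * toRat _ at hd
    rw [sub] at hd
    linear_combination (coeff m n k (s : FractionRing (MvPolynomial (Fin m × Fin n) K)) *
      toRat (genGram m n K).det ^ (s - 1)) * hd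

end Rat

/-! ### Polynomials -/

section Poly

variable {m n : ℕ}

theorem genGram_map {R R' : Type*} [CommRing R] [CommRing R'] (φ : R →+* R') :
    (genGram m n R).map (MvPolynomial.map φ) = genGram m n R' := by
  rw [genGram, genGram, Matrix.map_mul, Matrix.transpose_map]
  have : (genMat m n R).map (MvPolynomial.map φ) = genMat m n R' := by
    ext1 i j; simp [genMat]
  rw [this]

theorem det_genGram_map {R R' : Type*} [CommRing R] [CommRing R'] (φ : R →+* R') :
    MvPolynomial.map φ (genGram m n R).det = (genGram m n R').det := by
  rw [← genGram_map φ, RingHom.map_det]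
  rfl

/-- The identity has integer coefficients: it is proved in ℤ[x], by embedding in ℚ(x), and then
mapped to R[x]. -/
theorem poly_identity (hmn : m ≤ n) (R : Type*) [CommRing R] (s : ℕ) (hs : 1 ≤ s) :
      opDet (gramOp (polyD m n R)) ((genGram m n R).det ^ s) =
        coeff m n m (s : MvPolynomial (Fin m × Fin n) R) * (genGram m n R).det ^ (s - 1) ∧
      ∀ (k : ℕ) (I J : Finset (Fin m)) (hI : I.card = k) (hJ : J.card = k),
        opDet (sub (gramOp (polyD m n R)) hI hJ) ((genGram m n R).det ^ s) =
          coeff m n k (s : MvPolynomial (Fin m × Fin n) R) * (genGram m n R).det ^ (s - 1) *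
            ((eps I J : ℤ) * complMinor (genGram m n R) hI hJ) := by
  let φ : MvPolynomial (Fin m × Fin n) ℤ →+* MvPolynomial (Fin m × Fin n) R :=
    MvPolynomial.map (Int.castRingHom R)
  let ι : MvPolynomial (Fin m × Fin n) ℤ →+* MvPolynomial (Fin m × Fin n) ℚ :=
    MvPolynomial.map (Int.castRingHom ℚ)
  let ψ : MvPolynomial (Fin m × Fin n) ℤ →+* FractionRing (MvPolynomial (Fin m × Fin n) ℚ) :=
    (algebraMap (MvPolynomial (Fin m × Fin n) ℚ) _).comp ι
  have hψ : ∀ p, ψ p = toRat (ι p) := fun p => rfl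
  have hψinj : Function.Injective ψ :=
    fun a b hab => MvPolynomial.map_injective (Int.castRingHom ℚ) (RingHom.injective_int _)
      (FaithfulSMul.algebraMap_injective (MvPolynomial (Fin m × Fin n) ℚ)
        (FractionRing (MvPolynomial (Fin m × Fin n) ℚ)) hab)
  have hψP : ψ (genGram m n ℤ).det = toRat (genGram m n ℚ).det := by
    rw [hψ]; exact congrArg toRat (det_genGram_map _)
  have hφP : φ (genGram m n ℤ).det = (genGram m n R).det := det_genGram_map _
  have tψ : ∀ {k : ℕ} (r w : Fin k → Fin m) f,
      opDet ((gramOp (ratD m n ℚ)).submatrix r w) (ψ f) =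
        ψ (opDet ((gramOp (polyD m n ℤ)).submatrix r w) f) := fun r w f =>
    opDet_gramOp_map ψ.toAddMonoidHom (fun i c f => by
      change locD _ _ (algebraMap _ _ (ι f)) = algebraMap _ _ (ι (MvPolynomial.pderiv _ f))
      rw [locD_algebraMap, MvPolynomial.pderiv_map]) r w f
  have tφ : ∀ {k : ℕ} (r w : Fin k → Fin m) f,
      opDet ((gramOp (polyD m n R)).submatrix r w) (φ f) =
        φ (opDet ((gramOp (polyD m n ℤ)).submatrix r w) f) := fun r w f =>
    opDet_gramOp_map φ.toAddMonoidHom (fun i c f => by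
      change MvPolynomial.pderiv _ (φ f) = φ (MvPolynomial.pderiv _ f)
      exact MvPolynomial.pderiv_map) r w f
  have hrat := rat_identity hmn ℚ (s : ℤ)
  -- Truncated subtraction is harmless because s ≥ 1.
  have hzpow : ((s : ℤ) - 1) = ((s - 1 : ℕ) : ℤ) := by push_cast [hs]; ring
  rw [hzpow] at hrat
  simp only [zpow_natCast, Int.cast_natCast] at hrat
  refine ⟨?_, fun k I J hI hJ => ?_⟩
  · have hZ : opDet (gramOp (polyD m n ℤ)) ((genGram m n ℤ).det ^ s) =
        coeff m n m (s : MvPolynomial (Fin m × Fin n) ℤ) * (genGram m n ℤ).det ^ (s - 1) := by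
      apply hψinj
      have h := tψ (id : Fin m → Fin m) id ((genGram m n ℤ).det ^ s)
      rw [Matrix.submatrix_id_id, Matrix.submatrix_id_id] at h
      rw [← h, map_pow, map_mul, map_pow, map_coeff, map_natCast, hψP, hrat.1]
    have h := tφ (id : Fin m → Fin m) id ((genGram m n ℤ).det ^ s)
    rw [Matrix.submatrix_id_id, Matrix.submatrix_id_id, hZ, map_pow, map_mul, map_pow, map_coeff,
      map_natCast, hφP] at h
    exact h
  · have hZ : opDet (sub (gramOp (polyD m n ℤ)) hI hJ) ((genGram m n ℤ).det ^ s) =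
        coeff m n k (s : MvPolynomial (Fin m × Fin n) ℤ) * (genGram m n ℤ).det ^ (s - 1) *
          ((eps I J : ℤ) * complMinor (genGram m n ℤ) hI hJ) := by
      apply hψinj
      rw [sub, ← tψ, map_pow, map_mul, map_mul, map_mul, map_pow, map_coeff, map_natCast,
        map_intCast, hψP, ← sub, hrat.2 k I J hI hJ, hψ, ← complMinor_map ι, genGram_map]
    have h := tφ (I.orderEmbOfFin hI) (J.orderEmbOfFin hJ) ((genGram m n ℤ).det ^ s)
    rw [← sub, ← sub, hZ, map_pow, map_mul, map_mul, map_mul, map_pow, map_coeff, map_natCast,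
      map_intCast, hφP, ← complMinor_map φ, genGram_map] at h
    exact h

end Poly

/-! ### Symbolic exponent -/

section Sym

variable {m n : ℕ}

theorem opDet_symD (K : Type*) [Field K] {k : ℕ} (r w : Fin k → Fin m) :
    opDet ((gramOp (symD (genGram m n (Polynomial K)).det)).submatrix r w)
        (powS (genGram m n (Polynomial K)).det) =
      algebraMap (PolyS m n K) (SymPow (genGram m n (Polynomial K)).det)
        (coeff m n k (symS m n K)) *
        ((locMat m n (Submonoid.powers (genGram m n (Polynomial K)).det) *
          (locMat m n (Submonoid.powers (genGram m n (Polynomial K)).det)).transpose)⁻¹.submatrix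
            r w).det := by
  set P : PolyS m n K := (genGram m n (Polynomial K)).det with hPdef
  have hP : IsUnit (algebraMap (PolyS m n K) (SymPow P) P) :=
    IsLocalization.Away.algebraMap_isUnit P
  have hs : ∀ i c, locDer (Submonoid.powers P) (MvPolynomial.pderiv (i, c))
      (algebraMap (PolyS m n K) (SymPow P) (symS m n K)) = 0 := fun i c => by
    rw [locDer_algebraMap, symS, MvPolynomial.pderiv_C, map_zero]
  -- With `f` standing for f P^s, the prescribed derivative is already the twisted one, as (∂P) P⁻¹
  -- = 2Y.
  have htwist : symD P = fun i c => ⇑(twist (fun i c => locDer (Submonoid.powers P)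
      (MvPolynomial.pderiv (i, c))) ((locMat m n (Submonoid.powers P) *
        (locMat m n (Submonoid.powers P)).transpose)⁻¹ * locMat m n (Submonoid.powers P))
      (2 * algebraMap (PolyS m n K) (SymPow P) (symS m n K)) i c) := by
    funext i c f
    have h1 := locDer_det_gram (Submonoid.powers P) hP i c
    rw [← hPdef, locDer_algebraMap] at h1
    have h2 := IsLocalization.Away.mul_invSelf (S := SymPow P) P
    rw [symD, twist_apply, locDer_apply, h1]
    linear_combination (2 * algebraMap (PolyS m n K) (SymPow P) (symS m n K) * f *
      ((locMat m n (Submonoid.powers P) *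
        (locMat m n (Submonoid.powers P)).transpose)⁻¹ * locMat m n (Submonoid.powers P)) i c) * h2
  rw [map_coeff, htwist, powS]
  exact opDet_twist_loc (Submonoid.powers P) hP hs r w

theorem sym_identity (m n : ℕ) (K : Type*) [Field K] (P : PolyS m n K)
    (hPdef : P = (genGram m n (Polynomial K)).det) :
      opDet (gramOp (symD P)) (powS P) = coeff m n m (symS m n K) • powSPred P ∧
      ∀ (k : ℕ) (I J : Finset (Fin m)) (hI : I.card = k) (hJ : J.card = k),
        opDet (sub (gramOp (symD P)) hI hJ) (powS P) =
          (coeff m n k (symS m n K) *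
            ((eps I J : ℤ) * complMinor (genGram m n (Polynomial K)) hI hJ)) • powSPred P := by
  subst hPdef
  set P : PolyS m n K := (genGram m n (Polynomial K)).det with hPdef
  have hP : IsUnit (algebraMap (PolyS m n K) (SymPow P) P) :=
    IsLocalization.Away.algebraMap_isUnit P
  have h2 := IsLocalization.Away.mul_invSelf (S := SymPow P) P
  refine ⟨?_, fun k I J hI hJ => ?_⟩
  · have h := opDet_symD K (n := n) (id : Fin m → Fin m) id
    have hd := det_inv_locMat_mul (Submonoid.powers P) hP
    rw [Matrix.submatrix_id_id, Matrix.submatrix_id_id, ← hPdef] at h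
    rw [← hPdef] at hd
    rw [h, Algebra.smul_def, powSPred]
    congr 1
    refine hP.mul_right_cancel ?_
    rw [hd, mul_comm, h2]
  · have h := opDet_symD K (n := n) (I.orderEmbOfFin hI) (J.orderEmbOfFin hJ)
    have hd := det_sub_inv_locMat_mul (Submonoid.powers P) hP hI hJ
    rw [← hPdef] at h hd
    rw [sub, h, Algebra.smul_def, powSPred, map_mul, mul_assoc]
    congr 1
    refine hP.mul_right_cancel ?_
    rw [sub] at hd
    rw [hd, mul_assoc, mul_comm (IsLocalization.Away.invSelf P), h2, map_mul, map_intCast, mul_one]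

end Sym

/-! ### Functions of real or complex variables -/

section Analytic

variable {𝕜 : Type*} [NontriviallyNormedField 𝕜] [NormedAlgebra 𝕜 ℂ] {m n : ℕ}

/-- The value of a polynomial in `K[x, s]` at a matrix and a complex number. -/
def evalS (s : ℂ) (Y : Matrix (Fin m) (Fin n) 𝕜) : PolyS m n 𝕜 →+* ℂ :=
  MvPolynomial.eval₂Hom (Polynomial.eval₂RingHom (algebraMap 𝕜 ℂ) s)
    fun p => algebraMap 𝕜 ℂ (Y p.1 p.2)

theorem evalS_symS (s : ℂ) (Y : Matrix (Fin m) (Fin n) 𝕜) : evalS s Y (symS m n 𝕜) = s := by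
  simp [evalS, symS]

theorem evalS_genGram (s : ℂ) (Y : Matrix (Fin m) (Fin n) 𝕜) :
    (genGram m n (Polynomial 𝕜)).map (evalS s Y) = (Y * Y.transpose).map (algebraMap 𝕜 ℂ) := by
  ext i j
  simp [genGram, genMat, Matrix.mul_apply, evalS]

theorem evalS_det_genGram (s : ℂ) (Y : Matrix (Fin m) (Fin n) 𝕜) :
    evalS s Y (genGram m n (Polynomial 𝕜)).det = gramDet 𝕜 m n Y := by
  rw [gramDet, RingHom.map_det, RingHom.map_det, RingHom.mapMatrix_apply, evalS_genGram]
  rfl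

theorem hasDerivAt_evalS (s : ℂ) (Y : Matrix (Fin m) (Fin n) 𝕜) (i : Fin m) (c : Fin n)
    (q : PolyS m n 𝕜) :
    HasDerivAt (fun t : 𝕜 => evalS s (Y + t • Matrix.single i c 1) q)
      (evalS s Y (MvPolynomial.pderiv (i, c) q)) 0 := by
  induction q using MvPolynomial.induction_on with
  | C a =>
    have : ∀ Z : Matrix (Fin m) (Fin n) 𝕜, evalS s Z (MvPolynomial.C a) =
        Polynomial.eval₂RingHom (algebraMap 𝕜 ℂ) s a := fun Z => by simp [evalS]
    simp only [this, MvPolynomial.pderiv_C, map_zero]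
    exact hasDerivAt_const _ _
  | add p q hp hq =>
    simp only [map_add]
    exact hp.add hq
  | mul_X p l hp =>
    have hX : HasDerivAt (fun t : 𝕜 => evalS s (Y + t • Matrix.single i c 1) (MvPolynomial.X l))
        (evalS s Y (MvPolynomial.pderiv (i, c) (MvPolynomial.X l))) 0 := by
      have h1 : ∀ Z : Matrix (Fin m) (Fin n) 𝕜, evalS s Z (MvPolynomial.X l) =
        algebraMap 𝕜 ℂ (Z l.1 l.2) := fun Z => by simp [evalS]
      have h2 := ((hasDerivAt_id (0 : 𝕜)).smul_const
        (algebraMap 𝕜 ℂ (Matrix.single i c (1 : 𝕜) l.1 l.2))).const_add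
          (algebraMap 𝕜 ℂ (Y l.1 l.2))
      have h3 : (fun t : 𝕜 => evalS s (Y + t • Matrix.single i c 1) (MvPolynomial.X l)) =
          fun t => algebraMap 𝕜 ℂ (Y l.1 l.2) +
            id t • algebraMap 𝕜 ℂ (Matrix.single i c (1 : 𝕜) l.1 l.2) := by
        funext t
        rw [h1, Matrix.add_apply, Matrix.smul_apply, smul_eq_mul, map_add, map_mul,
          Algebra.smul_def, id]
      rw [h3]
      refine h2.congr_deriv ?_
      rw [one_smul, MvPolynomial.pderiv_X, Pi.single_apply, Matrix.single_apply]
      have h4 : (l = (i, c)) ↔ (i = l.1 ∧ c = l.2) := by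
        rw [Prod.ext_iff, eq_comm, @eq_comm _ l.2]
      simp only [h4]
      split_ifs <;> simp
    have h := hp.mul hX
    simp only [map_mul]
    refine h.congr_deriv ?_
    simp only [zero_smul, add_zero, Derivation.leibniz, smul_eq_mul, map_add, map_mul]
    ring

theorem gramDet_ne_zero_of_branch {s : ℂ} {U : Set (Matrix (Fin m) (Fin n) 𝕜)}
    {F : Matrix (Fin m) (Fin n) 𝕜 → ℂ} (hF : IsPowBranch (gramDet 𝕜 m n) s U F)
    {Y : Matrix (Fin m) (Fin n) 𝕜} (hY : Y ∈ U) : gramDet 𝕜 m n Y ≠ 0 := by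
  obtain ⟨V, hV, L, -, h⟩ := hF Y hY
  rw [← (h Y (mem_of_mem_nhds hV)).1]
  exact Complex.exp_ne_zero _

/-- L is only assumed continuous. Near Y it equals L(Y) + log(P/P(Y)) with the principal logarithm,
which is differentiable along the line. -/
theorem hasDerivAt_branch {s : ℂ} {U : Set (Matrix (Fin m) (Fin n) 𝕜)}
    {F : Matrix (Fin m) (Fin n) 𝕜 → ℂ} (hF : IsPowBranch (gramDet 𝕜 m n) s U F)
    {Y : Matrix (Fin m) (Fin n) 𝕜} (hY : Y ∈ U) (i : Fin m) (c : Fin n) :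
    HasDerivAt (fun t : 𝕜 => F (Y + t • Matrix.single i c 1))
      (s * (evalS s Y (MvPolynomial.pderiv (i, c) (genGram m n (Polynomial 𝕜)).det) /
        gramDet 𝕜 m n Y) * F Y) 0 := by
  have hP0 := gramDet_ne_zero_of_branch hF hY
  obtain ⟨V, hV, L, hL, h⟩ := hF Y hY
  set line : 𝕜 → Matrix (Fin m) (Fin n) 𝕜 := fun t => Y + t • Matrix.single i c 1 with hline
  have hline0 : line 0 = Y := by simp [hline]
  have hcont : Continuous line := by
    exact continuous_const.add (continuous_id.smul continuous_const)
  have hVt : ∀ᶠ t in 𝓝 (0 : 𝕜), line t ∈ V :=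
    hcont.continuousAt.eventually_mem (by rwa [hline0])
  have hLc : ContinuousAt (fun t => L (line t)) 0 := by
    have : ContinuousAt L (line 0) := by rw [hline0]; exact hL.continuousAt hV
    exact this.comp hcont.continuousAt
  -- Continuity keeps L - L(Y) in the strip where the principal logarithm inverts exp.
  have him : ∀ᶠ t in 𝓝 (0 : 𝕜), |(L (line t) - L Y).im| < Real.pi := by
    have h1 : ContinuousAt (fun t => |(L (line t) - L Y).im|) 0 :=
      (Complex.continuous_im.continuousAt.comp (hLc.sub continuousAt_const)).abs
    refine h1.eventually_lt continuousAt_const ?_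
    simp [hline0, Real.pi_pos]
  have hp := hasDerivAt_evalS s Y i c (genGram m n (Polynomial 𝕜)).det
  simp only [evalS_det_genGram] at hp
  have hq : HasDerivAt (fun t : 𝕜 => gramDet 𝕜 m n (line t) / gramDet 𝕜 m n Y)
      (evalS s Y (MvPolynomial.pderiv (i, c) (genGram m n (Polynomial 𝕜)).det) /
        gramDet 𝕜 m n Y) 0 := hp.div_const _
  have hlog : HasDerivAt (fun t : 𝕜 => Complex.log (gramDet 𝕜 m n (line t) / gramDet 𝕜 m n Y))
      (evalS s Y (MvPolynomial.pderiv (i, c) (genGram m n (Polynomial 𝕜)).det) /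
        gramDet 𝕜 m n Y) 0 := by
    have h1 : gramDet 𝕜 m n (line 0) / gramDet 𝕜 m n Y = 1 := by rw [hline0, div_self hP0]
    have h2 : HasDerivAt Complex.log 1⁻¹ (gramDet 𝕜 m n (line 0) / gramDet 𝕜 m n Y) := by
      rw [h1]; exact Complex.hasDerivAt_log Complex.one_mem_slitPlane
    have h3 := HasDerivAt.scomp (0 : 𝕜) h2 hq
    rw [inv_one, smul_eq_mul, mul_one] at h3
    exact h3
  have hexp : HasDerivAt (fun t : 𝕜 => Complex.exp
      (s * (L Y + Complex.log (gramDet 𝕜 m n (line t) / gramDet 𝕜 m n Y))))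
      (s * (evalS s Y (MvPolynomial.pderiv (i, c) (genGram m n (Polynomial 𝕜)).det) /
        gramDet 𝕜 m n Y) * F Y) 0 := by
    have h1 := (hlog.const_add (L Y)).const_mul s
    have h2 := HasDerivAt.scomp (0 : 𝕜) (Complex.hasDerivAt_exp _) h1
    refine h2.congr_deriv ?_
    rw [hline0, div_self hP0, Complex.log_one, add_zero, (h Y (mem_of_mem_nhds hV)).2,
      smul_eq_mul]
  refine hexp.congr_of_eventuallyEq ?_
  filter_upwards [hVt, him] with t ht1 ht2
  change F (line t) = _
  rw [(h _ ht1).2]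
  congr 2
  rw [abs_lt] at ht2
  rw [← (h _ ht1).1, ← (h Y (mem_of_mem_nhds hV)).1, ← Complex.exp_sub,
    Complex.log_exp ht2.1 ht2.2.le]
  ring

section Branch

variable {s : ℂ} {U : Set (Matrix (Fin m) (Fin n) 𝕜)} {F : Matrix (Fin m) (Fin n) 𝕜 → ℂ}

theorem isUnit_evalS_det (hF : IsPowBranch (gramDet 𝕜 m n) s U F)
    {Y : Matrix (Fin m) (Fin n) 𝕜} (hY : Y ∈ U) :
    IsUnit (evalS s Y (genGram m n (Polynomial 𝕜)).det) := by
  rw [evalS_det_genGram]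
  exact isUnit_iff_ne_zero.2 (gramDet_ne_zero_of_branch hF hY)

/-- The value of an element of `K[x, s, P⁻¹]` at a point of `U`. -/
def evalLoc (hF : IsPowBranch (gramDet 𝕜 m n) s U F) {Y : Matrix (Fin m) (Fin n) 𝕜} (hY : Y ∈ U) :
    SymPow (genGram m n (Polynomial 𝕜)).det →+* ℂ :=
  IsLocalization.Away.lift _ (isUnit_evalS_det hF hY)

theorem evalLoc_algebraMap (hF : IsPowBranch (gramDet 𝕜 m n) s U F)
    {Y : Matrix (Fin m) (Fin n) 𝕜} (hY : Y ∈ U) (q : PolyS m n 𝕜) :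
    evalLoc hF hY (algebraMap _ _ q) = evalS s Y q :=
  IsLocalization.Away.lift_eq _ _ q

theorem evalLoc_invSelf (hF : IsPowBranch (gramDet 𝕜 m n) s U F)
    {Y : Matrix (Fin m) (Fin n) 𝕜} (hY : Y ∈ U) :
    evalLoc hF hY (IsLocalization.Away.invSelf (genGram m n (Polynomial 𝕜)).det) =
      (gramDet 𝕜 m n Y)⁻¹ := by
  have h := congrArg (evalLoc hF hY) (IsLocalization.Away.mul_invSelf
    (S := SymPow (genGram m n (Polynomial 𝕜)).det) (genGram m n (Polynomial 𝕜)).det)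
  rw [map_mul, map_one, evalLoc_algebraMap, evalS_det_genGram] at h
  exact eq_inv_of_mul_eq_one_right h

/-- Pairs of an element `f P^s` of `K[x, s, P⁻¹] P^s` and a function that agrees with it on `U`. -/
def branchRel (hF : IsPowBranch (gramDet 𝕜 m n) s U F) :
    AddSubgroup (SymPow (genGram m n (Polynomial 𝕜)).det × (Matrix (Fin m) (Fin n) 𝕜 → ℂ)) where
  carrier := {p | ∀ Y (hY : Y ∈ U), p.2 Y = evalLoc hF hY p.1 * F Y}
  zero_mem' := fun Y hY => by simp
  add_mem' := fun {p q} hp hq Y hY => by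
    simp only [Prod.fst_add, Prod.snd_add, Pi.add_apply, map_add, hp Y hY, hq Y hY]
    ring
  neg_mem' := fun {p} hp Y hY => by
    simp only [Prod.fst_neg, Prod.snd_neg, Pi.neg_apply, map_neg, hp Y hY]
    ring

theorem mem_branchRel (hF : IsPowBranch (gramDet 𝕜 m n) s U F)
    {f : SymPow (genGram m n (Polynomial 𝕜)).det} {g : Matrix (Fin m) (Fin n) 𝕜 → ℂ} :
    (f, g) ∈ branchRel hF ↔ ∀ Y (hY : Y ∈ U), g Y = evalLoc hF hY f * F Y := Iff.rfl

/-- Since U is open, a derivative at a point of U sees only values on U, where the function is a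
fraction times F. -/
theorem branchRel_deriv (hU : IsOpen U) (hF : IsPowBranch (gramDet 𝕜 m n) s U F) (i : Fin m)
    (c : Fin n) (f : SymPow (genGram m n (Polynomial 𝕜)).det) (g : Matrix (Fin m) (Fin n) 𝕜 → ℂ)
    (h : (f, g) ∈ branchRel hF) :
    (symD (genGram m n (Polynomial 𝕜)).det i c f, funD 𝕜 m n i c g) ∈ branchRel hF := by
  rw [mem_branchRel] at h ⊢
  intro Y hY
  obtain ⟨a, b, hab⟩ := IsLocalization.exists_mk'_eq (Submonoid.powers (genGram m n (Polynomial 𝕜)).det) f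
  have hfb : f * algebraMap _ _ (b : PolyS m n 𝕜) =
      algebraMap (PolyS m n 𝕜) (SymPow (genGram m n (Polynomial 𝕜)).det) a := by
    rw [← hab]; exact IsLocalization.mk'_spec _ a b
  have hb : ∀ Z ∈ U, evalS s Z (b : PolyS m n 𝕜) ≠ 0 := by
    intro Z hZ
    obtain ⟨N, hN⟩ := b.2
    rw [← hN]
    simp only [map_pow]
    exact pow_ne_zero _ (isUnit_evalS_det hF hZ).ne_zero
  have hval : ∀ Z (hZ : Z ∈ U), g Z = evalS s Z a / evalS s Z b * F Z := by
    intro Z hZ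
    have h1 := congrArg (evalLoc hF hZ) hfb
    rw [map_mul, evalLoc_algebraMap, evalLoc_algebraMap] at h1
    rw [h Z hZ, ← h1, mul_div_cancel_right₀ _ (hb Z hZ)]
  set line : 𝕜 → Matrix (Fin m) (Fin n) 𝕜 := fun t => Y + t • Matrix.single i c 1 with hline
  have hline0 : line 0 = Y := by simp [hline]
  have hcont : Continuous line := continuous_const.add (continuous_id.smul continuous_const)
  have hUt : ∀ᶠ t in 𝓝 (0 : 𝕜), line t ∈ U :=
    hcont.continuousAt.eventually_mem (by rw [hline0]; exact hU.mem_nhds hY)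
  have hda := hasDerivAt_evalS s Y i c a
  have hdb := hasDerivAt_evalS s Y i c (b : PolyS m n 𝕜)
  have hdF := hasDerivAt_branch hF hY i c
  have hb0 : evalS s (Y + (0 : 𝕜) • Matrix.single i c 1) (b : PolyS m n 𝕜) ≠ 0 := by
    rw [zero_smul, add_zero]; exact hb Y hY
  have hd := ((hda.div hdb hb0).mul hdF).congr_of_eventuallyEq
    (f₁ := fun t : 𝕜 => g (line t)) (by
      filter_upwards [hUt] with t ht
      exact hval _ ht)
  have hfun : funD 𝕜 m n i c g Y = _ := hd.deriv
  rw [hfun]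
  simp only [zero_smul, add_zero, Pi.div_apply]
  -- Differentiating f b = a in the localization and evaluating at Y expresses the value of ∂f
  -- through polynomials.
  have hloc := congrArg (fun u => evalLoc hF hY (locDer (Submonoid.powers (genGram m n (Polynomial 𝕜)).det)
    (MvPolynomial.pderiv (i, c)) u)) hfb
  simp only [Derivation.leibniz, smul_eq_mul, locDer_algebraMap, map_add, map_mul,
    evalLoc_algebraMap] at hloc
  have hfb' := congrArg (evalLoc hF hY) hfb
  rw [map_mul, evalLoc_algebraMap, evalLoc_algebraMap] at hfb'
  rw [symD, map_add, map_mul, map_mul, map_mul, evalLoc_algebraMap, evalLoc_algebraMap,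
    evalLoc_invSelf, evalS_symS, ← locDer_apply, ← hloc, ← hfb']
  have hbY := hb Y hY
  have hPY := gramDet_ne_zero_of_branch hF hY
  field_simp
  ring

/-- The symbolic identity over 𝕜, carried through `branchRel`, which pairs P^s with F and is stable
under ∂. -/
theorem branch_identity (hU : IsOpen U) (hF : IsPowBranch (gramDet 𝕜 m n) s U F)
    {Y : Matrix (Fin m) (Fin n) 𝕜} (hY : Y ∈ U) :
      opDet (gramOp (funD 𝕜 m n)) F Y = coeff m n m s * (F Y / gramDet 𝕜 m n Y) ∧
      ∀ (k : ℕ) (I J : Finset (Fin m)) (hI : I.card = k) (hJ : J.card = k),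
        opDet (sub (gramOp (funD 𝕜 m n)) hI hJ) F Y =
          coeff m n k s * (F Y / gramDet 𝕜 m n Y) *
            ((eps I J : ℤ) * algebraMap 𝕜 ℂ (complMinor (Y * Y.transpose) hI hJ)) := by
  have h0 : (powS (genGram m n (Polynomial 𝕜)).det, F) ∈ branchRel hF := by
    rw [mem_branchRel]
    intro Z hZ
    rw [powS, map_one, one_mul]
  have hgram := gramOp_mem (branchRel hF) (branchRel_deriv hU hF)
  obtain ⟨hfull, hminor⟩ := sym_identity m n 𝕜 _ rfl
  refine ⟨?_, fun k I J hI hJ => ?_⟩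
  · have h := (mem_branchRel hF).1 (opDet_mem (branchRel hF) hgram h0) Y hY
    rw [h, hfull, Algebra.smul_def, map_mul, evalLoc_algebraMap, powSPred, evalLoc_invSelf,
      map_coeff, evalS_symS, div_eq_inv_mul, mul_assoc]
  · have h := (mem_branchRel hF).1 (opDet_mem (A := sub (gramOp (symD _)) hI hJ)
      (A' := sub (gramOp (funD 𝕜 m n)) hI hJ) (branchRel hF) (fun a b => hgram _ _) h0) Y hY
    rw [h, hminor k I J hI hJ, Algebra.smul_def, map_mul, evalLoc_algebraMap, powSPred,
      evalLoc_invSelf, map_mul, map_coeff, evalS_symS, map_mul, map_intCast,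
      ← complMinor_map (evalS s Y), evalS_genGram, complMinor_map]
    ring

end Branch

end Analytic

end

end RectCayley

open RectCayley in
/-- Both identities, in each reading of `P^s`, `P = det (X Xᵀ)`: polynomials over any commutative
ring (`s ≥ 1` an integer), rational fractions over any field (`s` an integer), symbolic `s`, and
branches of `P^s` (`s` complex) as functions of real or of complex matrices. -/
theorem theorem2p7 (m n : ℕ) (hmn : m ≤ n) :
    -- polynomials
    (∀ (R : Type*) [CommRing R] (s : ℕ), 1 ≤ s →
      opDet (gramOp (polyD m n R)) ((genGram m n R).det ^ s) =
        coeff m n m (s : MvPolynomial (Fin m × Fin n) R) * (genGram m n R).det ^ (s - 1) ∧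
      ∀ (k : ℕ) (I J : Finset (Fin m)) (hI : I.card = k) (hJ : J.card = k),
        opDet (sub (gramOp (polyD m n R)) hI hJ) ((genGram m n R).det ^ s) =
          coeff m n k (s : MvPolynomial (Fin m × Fin n) R) * (genGram m n R).det ^ (s - 1) *
            ((eps I J : ℤ) * complMinor (genGram m n R) hI hJ)) ∧
    -- rational fractions
    (∀ (K : Type*) [Field K] (s : ℤ),
      opDet (gramOp (ratD m n K)) (toRat (genGram m n K).det ^ s) =
        coeff m n m (s : FractionRing (MvPolynomial (Fin m × Fin n) K)) *
          toRat (genGram m n K).det ^ (s - 1) ∧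
      ∀ (k : ℕ) (I J : Finset (Fin m)) (hI : I.card = k) (hJ : J.card = k),
        opDet (sub (gramOp (ratD m n K)) hI hJ) (toRat (genGram m n K).det ^ s) =
          coeff m n k (s : FractionRing (MvPolynomial (Fin m × Fin n) K)) *
            toRat (genGram m n K).det ^ (s - 1) *
            ((eps I J : ℤ) * toRat (complMinor (genGram m n K) hI hJ))) ∧
    -- symbolic exponent, in the module `K[x, s, P⁻¹] P^s`
    (∀ (K : Type*) [Field K] [CharZero K] (P : PolyS m n K),
      P = (genGram m n (Polynomial K)).det →
      opDet (gramOp (symD P)) (powS P) = coeff m n m (symS m n K) • powSPred P ∧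
      ∀ (k : ℕ) (I J : Finset (Fin m)) (hI : I.card = k) (hJ : J.card = k),
        opDet (sub (gramOp (symD P)) hI hJ) (powS P) =
          (coeff m n k (symS m n K) *
            ((eps I J : ℤ) * complMinor (genGram m n (Polynomial K)) hI hJ)) • powSPred P) ∧
    -- functions of real variables
    (∀ (s : ℂ) (U : Set (Matrix (Fin m) (Fin n) ℝ)) (F : Matrix (Fin m) (Fin n) ℝ → ℂ),
      IsOpen U → IsPowBranch (gramDet ℝ m n) s U F → ∀ Y ∈ U,
      opDet (gramOp (funD ℝ m n)) F Y = coeff m n m s * (F Y / gramDet ℝ m n Y) ∧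
      ∀ (k : ℕ) (I J : Finset (Fin m)) (hI : I.card = k) (hJ : J.card = k),
        opDet (sub (gramOp (funD ℝ m n)) hI hJ) F Y =
          coeff m n k s * (F Y / gramDet ℝ m n Y) *
            ((eps I J : ℤ) * algebraMap ℝ ℂ (complMinor (Y * Y.transpose) hI hJ))) ∧
    -- functions of complex variables
    (∀ (s : ℂ) (U : Set (Matrix (Fin m) (Fin n) ℂ)) (F : Matrix (Fin m) (Fin n) ℂ → ℂ),
      IsOpen U → IsPowBranch (gramDet ℂ m n) s U F → ∀ Y ∈ U,
      opDet (gramOp (funD ℂ m n)) F Y = coeff m n m s * (F Y / gramDet ℂ m n Y) ∧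
      ∀ (k : ℕ) (I J : Finset (Fin m)) (hI : I.card = k) (hJ : J.card = k),
        opDet (sub (gramOp (funD ℂ m n)) hI hJ) F Y =
          coeff m n k s * (F Y / gramDet ℂ m n Y) *
            ((eps I J : ℤ) * complMinor (Y * Y.transpose) hI hJ)) := by
  refine ⟨fun R _ s hs => poly_identity hmn R s hs, fun K _ s => rat_identity hmn K s,
    fun K _ _ P hP => sym_identity m n K P hP, fun s U F hU hF Y hY => branch_identity hU hF hY,
    -- Over ℂ the map `algebraMap ℂ ℂ` is the identity by definition.
    fun s U F hU hF Y hY => branch_identity hU hF hY⟩
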